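/- Let $n\ge 1$, $0<s<1$, $1<p<\infty$, let $\Omega\subset\mathbb R^n$ be a bounded open set, $\Omega_e:=\mathbb R^n\setminus\overline\Omega$, and let $W\subset\Omega_e$ be a nonempty open set. Write $d_su(x,y)=\frac{u(x)-u(y)}{|x-y|^s}$ and $d\mu=\frac{dx\,dy}{|x-y|^n}$ on $\mathbb R^n\times\mathbb R^n$; let $W^{s,p}(\mathbb R^n)$ be the space of real-valued $u\in L^p(\mathbb R^n)$ with $d_su\in L^p(\mu)$, normed by $\|u\|_{W^{s,p}}=\big(\|u\|_{L^p}^p+\|d_su\|_{L^p(\mu)}^p\big)^{1/p}$, and let $\widetilde W^{s,p}(\Omega)$ be the closure of $C_c^\infty(\Omega)$ in $W^{s,p}(\mathbb R^n)$. For a measurable $\sigma:\mathbb R^n\times\mathbb R^n\to\mathbb R$ with $\lambda\le\sigma(x,y)\le\lambda^{-1}$ for all $x,y$ and some constant $\lambda>0$, and for $f\in W^{s,p}(\mathbb R^n)$, let $u_f$ be the unique function $u\in W^{s,p}(\mathbb R^n)$ such that $u-f\in\widetilde W^{s,p}(\Omega)$ and $$\int_{\mathbb R^{2n}}\sigma\,|d_su|^{p-2}d_su\,d_s\varphi\,d\mu=0\qquad\text{for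 all }\varphi\in C_c^\infty(\Omega).$$ The Dirichlet-to-Neumann map $\Lambda_\sigma$ is defined by $$\langle\Lambda_\sigma f,g\rangle=\int_{\mathbb R^{2n}}\sigma\,|d_su_f|^{p-2}d_su_f\,d_sg\,d\mu ,\qquad f,g\in W^{s,p}(\mathbb R^n).$$ Let $\sigma_1,\sigma_2:\mathbb R^n\times\mathbb R^n\to\mathbb R$ be measurable. Assume that, for $j=1,2$, there is $\lambda_j>0$ with $\lambda_j\le\sigma_j(x,y)\le\lambda_j^{-1}$ for all $x,y\in\mathbb R^n$, and that for every $x_0\in W$ the family $(\sigma_j(x,\cdot):W\to\mathbb R)_{x\in\mathbb R^n}$ is equicontinuous at $x_0$ and the function $\sigma_j(\cdot,x_0)$ is continuous on $W$. Suppose that $\Lambda_{\sigma_1}f|_W=\Lambda_{\sigma_2}f|_W$ for all $f\in C_c^\infty(W)$, that is, $\langle\Lambda_{\sigma_1}f,g\rangle=\langle\Lambda_{\sigma_2}f,g\rangle$ for all $f,g\in C_c^\infty(W)$. Then $\sigma_1(x,x)=\sigma_2(x,x)$ for every $x\in W$. -/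

import Mathlib

open MeasureTheory
open scoped ENNReal ContDiff

namespace FracPLap

noncomputable section

/-- Euclidean space `ℝⁿ`. -/
abbrev Rn (n : ℕ) : Type := EuclideanSpace ℝ (Fin n)

/-- The measure `dμ = dx dy / |x - y|ⁿ` on `ℝⁿ × ℝⁿ`. -/
def offDiagMeasure (n : ℕ) : Measure (Rn n × Rn n) :=
  (volume : Measure (Rn n × Rn n)).withDensity
    (fun z => ENNReal.ofReal ((‖z.1 - z.2‖ ^ n)⁻¹))

/-- The fractional `s`-gradient `d_s u (x, y) = (u x - u y) / |x - y| ^ s`. -/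
def sGrad {n : ℕ} (s : ℝ) (u : Rn n → ℝ) (z : Rn n × Rn n) : ℝ :=
  (u z.1 - u z.2) / ‖z.1 - z.2‖ ^ s

/-- The Gagliardo seminorm
`[u]_{W^{s,p}(ℝⁿ)} = (∫∫ |u x - u y| ^ p / |x - y| ^ (n + s p) dx dy) ^ (1 / p)`,
that is, the `L^p(μ)` norm of `d_s u`, as an extended nonnegative number. -/
def gagliardoSeminorm {n : ℕ} (s p : ℝ) (u : Rn n → ℝ) : ℝ≥0∞ :=
  eLpNorm (sGrad s u) (ENNReal.ofReal p) (offDiagMeasure n)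

/-- The norm `(‖u‖_{L^p}^p + [u]_{W^{s,p}}^p) ^ (1 / p)` on `W^{s,p}(ℝⁿ)`. -/
def sobolevNorm {n : ℕ} (s p : ℝ) (u : Rn n → ℝ) : ℝ≥0∞ :=
  (eLpNorm u (ENNReal.ofReal p) volume ^ p + gagliardoSeminorm s p u ^ p) ^ (1 / p)

/-- `u ∈ W^{s,p}(ℝⁿ)`. -/
def MemW {n : ℕ} (s p : ℝ) (u : Rn n → ℝ) : Prop :=
  MemLp u (ENNReal.ofReal p) volume ∧ gagliardoSeminorm s p u < ⊤

/-- `φ ∈ C_c^∞(U)`, extended by zero to all of `ℝⁿ`. -/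
def IsTestFunction {n : ℕ} (U : Set (Rn n)) (φ : Rn n → ℝ) : Prop :=
  ContDiff ℝ ∞ φ ∧ HasCompactSupport φ ∧ tsupport φ ⊆ U

/-- `u` belongs to the closure of `C_c^∞(Ω)` in `W^{s,p}(ℝⁿ)`. -/
def MemWTilde {n : ℕ} (s p : ℝ) (Ω : Set (Rn n)) (u : Rn n → ℝ) : Prop :=
  MemW s p u ∧ ∀ ε : ℝ≥0∞, 0 < ε → ∃ φ, IsTestFunction Ω φ ∧ sobolevNorm s p (u - φ) < ε

/-- The exterior `Ω_e` of `Ω`. -/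
def exterior {n : ℕ} (Ω : Set (Rn n)) : Set (Rn n) := (closure Ω)ᶜ

/-- The weak form of the weighted fractional `p`-Laplacian,
`⟨div_s (σ |d_s u|^{p-2} d_s u), φ⟩ = ∫ σ |d_s u|^{p-2} d_s u d_s φ dμ`. -/
def weakForm {n : ℕ} (s p : ℝ) (σ : Rn n → Rn n → ℝ) (u φ : Rn n → ℝ) : ℝ :=
  ∫ z, σ z.1 z.2 * |sGrad s u z| ^ (p - 2) * sGrad s u z * sGrad s φ z ∂(offDiagMeasure n)

/-- `u ∈ W^{s,p}(ℝⁿ)` is a weak solution of `div_s (σ |d_s u|^{p-2} d_s u) = 0` in `Ω`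
with `u = f` in the exterior of `Ω`. -/
structure IsWeakSolution {n : ℕ} (s p : ℝ) (σ : Rn n → Rn n → ℝ) (Ω : Set (Rn n))
    (f u : Rn n → ℝ) : Prop where
  memW : MemW s p u
  eq_zero : ∀ φ, IsTestFunction Ω φ → weakForm s p σ u φ = 0
  exterior_value : MemWTilde s p Ω (u - f)

/-- The weak solution `u_f` with exterior value `f` (for uniformly elliptic `σ` and
`f ∈ W^{s,p}(ℝⁿ)` it exists and is unique up to almost everywhere equality). -/
def solution {n : ℕ} (s p : ℝ) (σ : Rn n → Rn n → ℝ) (Ω : Set (Rn n))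
    (f : Rn n → ℝ) : Rn n → ℝ :=
  Classical.epsilon (fun u => IsWeakSolution s p σ Ω f u)

/-- The Dirichlet-to-Neumann map:
`⟨Λ_σ f, g⟩ = ∫ σ |d_s u_f|^{p-2} d_s u_f d_s g dμ`, evaluated on representatives `f`, `g` of
elements of the abstract trace space. -/
def dnMap {n : ℕ} (s p : ℝ) (σ : Rn n → Rn n → ℝ) (Ω : Set (Rn n))
    (f : Rn n → ℝ) : (Rn n → ℝ) → ℝ :=
  fun g => weakForm s p σ (solution s p σ Ω f) g

/-- Two functionals agree on the open set `W`, as distributions. -/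
def EqAsDistributionOn {n : ℕ} (W : Set (Rn n)) (T₁ T₂ : (Rn n → ℝ) → ℝ) : Prop :=
  ∀ g, IsTestFunction W g → T₁ g = T₂ g

/-- The hypotheses on the coefficient: `σ` is Lebesgue measurable and uniformly elliptic, and for
every `x₀ ∈ W` the family `(σ(x, ·) : W → ℝ)`, indexed by all `x ∈ ℝⁿ`, is equicontinuous at `x₀`,
and `σ(·, x₀)` is continuous on `W`. -/
structure IsAdmissible {n : ℕ} (W : Set (Rn n)) (σ : Rn n → Rn n → ℝ) : Prop where
  aemeasurable : AEMeasurable (fun z : Rn n × Rn n => σ z.1 z.2) volume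
  elliptic : ∃ lam : ℝ, 0 < lam ∧ ∀ x y, lam ≤ σ x y ∧ σ x y ≤ lam⁻¹
  equicontinuous : ∀ x₀ ∈ W, EquicontinuousWithinAt σ W x₀
  continuousOn : ∀ x₀ ∈ W, ContinuousOn (fun x => σ x x₀) W

end

end FracPLap

/-! The diagonal values of the data, `⟨Λ_σ f, f⟩`, already determine `σ` on the diagonal of `W`.
Testing the equation with `u_f - f` shows that `⟨Λ_σ f, f⟩` is the energy `E_σ(u_f) = ∫ σ |d_s
u_f|^p dμ` (`dnMap_self`), and Young's inequality then gives `E_σ(u_f) ≤ E_σ(f)`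
(`IsWeakSolution.energy_le`).

Conversely, if `f` is supported at distance at least `r` from `Ω`, then `u_f` differs from `f` only
inside `Ω`, where `f = 0`. Pairs of points both outside `Ω` contribute equally to the two energies.
The remaining pairs contribute to `E_σ(f)` no singular part, only a multiple of `‖f‖_p^p`. Hence
`E_σ(f) ≤ E_σ(u_f) + C ‖f‖_p^p`, with leading constant exactly one (`energy_le_energy_add`). Equal
data therefore give `E_{σ₁}(f) ≤ E_{σ₂}(f) + C ‖f‖_p^p` (`energy_le_of_dnMap_eq`).

Now let `f(x) = η(k(x - x₀))` with `k → ∞`. The energies scale like `k^(sp - n)` but `‖f‖_p^p` like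
`k^(-n)`, so after division the error is `O(k^(-sp))`. By joint continuity of `σ` at `(x₀, x₀)` and
dominated convergence, the rescaled energies tend to `σ(x₀, x₀)` times the energy of `η` with
coefficient one (`tendsto_rescaled_energy`). This yields one inequality between the diagonal values
(`diag_le_diag`); exchanging `σ₁` and `σ₂` yields the other.

Since `solution` is a choice by `Classical.epsilon`, existence of a weak solution has to be proved
(`exists_isWeakSolution`): the weighted `L^p` norm of the fractional gradient is minimized using a
quantitative convexity estimate, and the Poincaré inequality recovers a function from the limiting
gradient. Uniqueness is not needed, because the energy estimates hold for every weak solution. -/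

namespace FracPLap

open Filter Topology Set

/-! ### Convexity of `|x|^p` on the real line -/

/-- The duality map `x ↦ |x|^(p-2) x` of the real line. -/
noncomputable def dualityMap (p x : ℝ) : ℝ := |x| ^ (p - 2) * x

lemma abs_dualityMap {p : ℝ} (hp : 1 < p) (x : ℝ) : |dualityMap p x| = |x| ^ (p - 1) := by
  rcases eq_or_ne x 0 with rfl | hx
  · simp [dualityMap, Real.zero_rpow (sub_ne_zero.2 hp.ne')]
  · rw [dualityMap, abs_mul, abs_of_nonneg (by positivity),
      show p - 1 = (p - 2) + 1 by ring, Real.rpow_add (abs_pos.2 hx), Real.rpow_one]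

lemma dualityMap_mul_self {p : ℝ} (hp : 1 < p) (x : ℝ) : dualityMap p x * x = |x| ^ p := by
  rcases eq_or_ne x 0 with rfl | hx
  · simp [dualityMap, Real.zero_rpow (by linarith : p ≠ 0)]
  · rw [dualityMap, mul_assoc, ← abs_mul_abs_self x, ← mul_assoc]
    conv_rhs => rw [show p = (p - 2) + 1 + 1 by ring, Real.rpow_add (abs_pos.2 hx),
      Real.rpow_add (abs_pos.2 hx), Real.rpow_one]

lemma continuous_dualityMap {p : ℝ} (hp : 1 < p) : Continuous (dualityMap p) := by
  rw [continuous_iff_continuousAt]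
  intro x
  rcases eq_or_ne x 0 with rfl | hx
  · have h0 : dualityMap p 0 = 0 := by simp [dualityMap]
    rw [ContinuousAt, h0]
    -- For `p < 2` the factor `|y|^(p-2)` blows up at the origin, so continuity there has to come
    -- from the product, whose modulus is `|y|^(p-1)`.
    apply squeeze_zero_norm (a := fun y : ℝ => |y| ^ (p - 1))
    · intro y
      rw [Real.norm_eq_abs, abs_dualityMap hp]
    · have : Continuous (fun y : ℝ => |y| ^ (p - 1)) :=
        continuous_abs.rpow_const (fun y => Or.inr (by linarith))
      simpa [Real.zero_rpow (sub_ne_zero.2 hp.ne')] using this.tendsto 0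
  · exact ((continuous_abs.continuousAt).rpow_const (Or.inl (abs_pos.2 hx).ne')).mul
      continuousAt_id

/-- Young's inequality for the duality map. -/
lemma mul_dualityMap_mul_le {p : ℝ} (hp : 1 < p) (c a : ℝ) :
    p * (dualityMap p c * a) ≤ (p - 1) * |c| ^ p + |a| ^ p := by
  have hpq := Real.HolderConjugate.conjExponent hp
  have h := Real.young_inequality_of_nonneg (abs_nonneg a)
    (Real.rpow_nonneg (abs_nonneg c) (p - 1)) hpq
  have h2 : (|c| ^ (p - 1)) ^ (p.conjExponent) = |c| ^ p := by
    rw [← Real.rpow_mul (abs_nonneg c), Real.conjExponent,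
      mul_div_cancel₀ _ (sub_ne_zero.2 hp.ne')]
  rw [h2] at h
  have h3 : dualityMap p c * a ≤ |a| * |c| ^ (p - 1) := by
    calc dualityMap p c * a ≤ |dualityMap p c * a| := le_abs_self _
      _ = _ := by rw [abs_mul, abs_dualityMap hp, mul_comm]
  have hp0 : 0 < p := by linarith
  calc p * (dualityMap p c * a) ≤ p * (|a| ^ p / p + |c| ^ p / p.conjExponent) :=
        mul_le_mul_of_nonneg_left (h3.trans h) hp0.le
    _ = (p - 1) * |c| ^ p + |a| ^ p := by
        rw [Real.conjExponent]
        have : p - 1 ≠ 0 := sub_ne_zero.2 hp.ne'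
        field_simp
        ring

/-- The graph of the convex function `|x|^p` lies above its tangent line at `c`, whose slope is `p`
times the duality map. -/
lemma abs_rpow_add_le {p : ℝ} (hp : 1 < p) (c a : ℝ) :
    |c| ^ p + p * (dualityMap p c * (a - c)) ≤ |a| ^ p := by
  have h1 := mul_dualityMap_mul_le hp c a
  have h2 := dualityMap_mul_self hp c
  rw [mul_sub, h2]
  linarith

/-- Strict convexity of `t^p` on the half line applies to `|a|` and `|b|` unless these coincide;
then `a ≠ b` forces `b = -a`, and the midpoint is zero. -/
lemma midpoint_rpow_lt {p : ℝ} (hp : 1 < p) {a b : ℝ} (hab : a ≠ b) :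
    2 * |(a + b) / 2| ^ p < |a| ^ p + |b| ^ p := by
  have hp0 : 0 < p := by linarith
  have hle : |(a + b) / 2| ≤ (|a| + |b|) / 2 := by
    rw [abs_div, abs_two]; gcongr; exact abs_add_le a b
  by_cases h : |a| = |b|
  · have hb : b = -a := by
      rcases abs_eq_abs.1 h with h | h
      · exact absurd h hab
      · rw [h]; ring
    subst hb
    have ha : a ≠ 0 := by rintro rfl; simp at hab
    have : 0 < |a| ^ p := Real.rpow_pos_of_pos (abs_pos.2 ha) p
    simp only [add_neg_cancel, zero_div, abs_zero, Real.zero_rpow hp0.ne', abs_neg]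
    linarith
  · have h1 := (strictConvexOn_rpow hp).2 (abs_nonneg a) (abs_nonneg b) h
      (by norm_num : (0 : ℝ) < 1 / 2) (by norm_num : (0 : ℝ) < 1 / 2) (by norm_num)
    simp only [smul_eq_mul] at h1
    have h2 : |(a + b) / 2| ^ p ≤ (1 / 2 * |a| + 1 / 2 * |b|) ^ p := by
      apply Real.rpow_le_rpow (abs_nonneg _) _ hp0.le
      linarith
    linarith

lemma midpoint_rpow_le {p : ℝ} (hp : 1 < p) (a b : ℝ) :
    2 * |(a + b) / 2| ^ p ≤ |a| ^ p + |b| ^ p := by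
  rcases eq_or_ne a b with rfl | h
  · rw [← two_mul, ← two_mul, mul_div_cancel_left₀ _ two_ne_zero]
  · exact (midpoint_rpow_lt hp h).le

/-- A quantitative form of the strict convexity of `|x|^p`. -/
lemma exists_abs_sub_rpow_le {p : ℝ} (hp : 1 < p) {ε : ℝ} (hε : 0 < ε) :
    ∃ C : ℝ, 0 ≤ C ∧ ∀ a b : ℝ, |a - b| ^ p ≤
      ε * (|a| ^ p + |b| ^ p) + C * (|a| ^ p + |b| ^ p - 2 * |(a + b) / 2| ^ p) := by
  have hp0 : 0 < p := by linarith
  have hc : Continuous (fun x : ℝ => |x| ^ p) :=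
    continuous_abs.rpow_const (fun y => Or.inr hp0.le)
  -- By homogeneity it suffices to treat pairs of norm one, and among these the ones where the `ε`
  -- term does not already dominate. They form a compact set missing the diagonal, so the convexity
  -- defect has a positive lower bound `δ` on it.
  let K : Set (ℝ × ℝ) := Metric.sphere 0 1 ∩
    {z | ε * (|z.1| ^ p + |z.2| ^ p) ≤ |z.1 - z.2| ^ p}
  have c1 : Continuous fun z : ℝ × ℝ => |z.1| ^ p := hc.comp continuous_fst
  have c2 : Continuous fun z : ℝ × ℝ => |z.2| ^ p := hc.comp continuous_snd
  have c3 : Continuous fun z : ℝ × ℝ => |z.1 - z.2| ^ p :=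
    hc.comp (continuous_fst.sub continuous_snd)
  have c4 : Continuous fun z : ℝ × ℝ => |(z.1 + z.2) / 2| ^ p :=
    hc.comp ((continuous_fst.add continuous_snd).div_const 2)
  have hK : IsCompact K :=
    (isCompact_sphere 0 1).inter_right (isClosed_le ((c1.add c2).const_smul ε) c3)
  have hne : ∀ z ∈ K, z.1 ≠ z.2 := by
    rintro ⟨a, b⟩ ⟨h1, h2⟩ (rfl : a = b)
    simp only [mem_ofPred_eq, sub_self, abs_zero, Real.zero_rpow hp0.ne'] at h2
    have ha : a ≠ 0 := by
      rintro rfl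
      simp at h1
    have : 0 < |a| ^ p := Real.rpow_pos_of_pos (abs_pos.2 ha) p
    nlinarith
  obtain ⟨δ, hδ, hδK⟩ : ∃ δ : ℝ, 0 < δ ∧
      ∀ z ∈ K, δ ≤ |z.1| ^ p + |z.2| ^ p - 2 * |(z.1 + z.2) / 2| ^ p := by
    rcases K.eq_empty_or_nonempty with h | h
    · exact ⟨1, one_pos, by simp [h]⟩
    · obtain ⟨z, hz, hmin⟩ := hK.exists_isMinOn h
        ((c1.add c2).sub (c4.const_smul (2 : ℝ))).continuousOn
      refine ⟨_, sub_pos.2 (midpoint_rpow_lt hp (hne z hz)), fun w hw => hmin hw⟩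
  -- On the unit sphere of the sup norm `|a - b| ≤ 2`, so `2^p` bounds the left side and `δ` bounds
  -- the defect from below.
  refine ⟨2 ^ p / δ, by positivity, fun a b => ?_⟩
  have key : ∀ a b : ℝ, ‖(a, b)‖ = 1 → |a - b| ^ p ≤
      ε * (|a| ^ p + |b| ^ p) + 2 ^ p / δ * (|a| ^ p + |b| ^ p - 2 * |(a + b) / 2| ^ p) := by
    intro a b h1
    have hnn : 0 ≤ |a| ^ p + |b| ^ p - 2 * |(a + b) / 2| ^ p :=
      sub_nonneg.2 (midpoint_rpow_le hp a b)
    by_cases h2 : ε * (|a| ^ p + |b| ^ p) ≤ |a - b| ^ p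
    · have h3 := hδK (a, b) ⟨by simpa using h1, h2⟩
      simp only at h3
      have ha : |a| ≤ 1 := h1 ▸ norm_fst_le (a, b)
      have hb : |b| ≤ 1 := h1 ▸ norm_snd_le (a, b)
      have h4 : |a - b| ^ p ≤ 2 ^ p := by
        apply Real.rpow_le_rpow (abs_nonneg _) _ hp0.le
        linarith [abs_sub a b]
      have h5 : (2 : ℝ) ^ p = 2 ^ p / δ * δ := by field_simp
      have h6 : 2 ^ p / δ * δ ≤ 2 ^ p / δ * (|a| ^ p + |b| ^ p - 2 * |(a + b) / 2| ^ p) := by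
        gcongr
      have h7 : 0 ≤ ε * (|a| ^ p + |b| ^ p) := by positivity
      linarith
    · have : 0 ≤ 2 ^ p / δ * (|a| ^ p + |b| ^ p - 2 * |(a + b) / 2| ^ p) := by positivity
      linarith
  -- Both sides are homogeneous of degree `p`, so the general case follows by dividing by the norm.
  rcases eq_or_ne (a, b) 0 with h | h
  · obtain ⟨rfl, rfl⟩ := Prod.mk_eq_zero.1 h
    simp [Real.zero_rpow hp0.ne']
  · set r := ‖(a, b)‖ with hr
    have hr0 : 0 < r := norm_pos_iff.2 h
    have h1 : ‖(r⁻¹ * a, r⁻¹ * b)‖ = 1 := by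
      have : (r⁻¹ * a, r⁻¹ * b) = r⁻¹ • (a, b) := rfl
      rw [this, norm_smul, norm_inv, Real.norm_of_nonneg hr0.le, ← hr, inv_mul_cancel₀ hr0.ne']
    have h2 := key _ _ h1
    have e : ∀ x : ℝ, |r⁻¹ * x| ^ p = (r⁻¹) ^ p * |x| ^ p := fun x => by
      rw [abs_mul, Real.mul_rpow (abs_nonneg _) (abs_nonneg _), abs_of_pos (inv_pos.2 hr0)]
    rw [← mul_sub, ← mul_add, mul_div_assoc, e, e, e, e] at h2
    have h3 : 0 < (r⁻¹) ^ p := by positivity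
    refine le_of_mul_le_mul_left (h2.trans (le_of_eq ?_)) h3
    ring

/-! ### Minimization and the Euler–Lagrange equation in `L^p` -/

section Lp

variable {α : Type*} [MeasurableSpace α] {ν : Measure α} {p : ℝ}

lemma integrable_abs_rpow (hp : 1 < p) {U : α → ℝ} (hU : MemLp U (ENNReal.ofReal p) ν) :
    Integrable (fun x => |U x| ^ p) ν := by
  have hp0 : 0 < p := by linarith
  have := hU.integrable_norm_rpow (ENNReal.ofReal_pos.2 hp0).ne' ENNReal.ofReal_ne_top
  simpa only [ENNReal.toReal_ofReal hp0.le, Real.norm_eq_abs] using this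

lemma abs_dualityMap_mul_le (hp : 1 < p) (a b : ℝ) :
    |dualityMap p a * b| ≤ p⁻¹ * ((p - 1) * |a| ^ p + |b| ^ p) := by
  have hp0 : 0 < p := by linarith
  rw [← div_eq_inv_mul, le_div_iff₀' hp0]
  rcases abs_cases (dualityMap p a * b) with h | h
  · rw [h.1]; exact mul_dualityMap_mul_le hp a b
  · rw [h.1, ← mul_neg, ← abs_neg b]; exact mul_dualityMap_mul_le hp a (-b)

lemma integrable_dualityMap_mul (hp : 1 < p) {U V : α → ℝ}
    (hU : MemLp U (ENNReal.ofReal p) ν) (hV : MemLp V (ENNReal.ofReal p) ν) :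
    Integrable (fun x => dualityMap p (U x) * V x) ν := by
  refine ((((integrable_abs_rpow hp hU).const_mul (p - 1)).add
    (integrable_abs_rpow hp hV)).const_mul p⁻¹).mono' ?_ ?_
  · exact ((continuous_dualityMap hp).comp_aestronglyMeasurable hU.1).mul hV.1
  · exact Eventually.of_forall fun x => abs_dualityMap_mul_le hp _ _

lemma eLpNorm_eq_ofReal_integral (hp : 1 < p) {U : α → ℝ}
    (hU : MemLp U (ENNReal.ofReal p) ν) :
    eLpNorm U (ENNReal.ofReal p) ν = ENNReal.ofReal ((∫ x, |U x| ^ p ∂ν) ^ p⁻¹) := by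
  have hp0 : 0 < p := by linarith
  have := hU.eLpNorm_eq_integral_rpow_norm (ENNReal.ofReal_pos.2 hp0).ne' ENNReal.ofReal_ne_top
  simpa only [ENNReal.toReal_ofReal hp0.le, Real.norm_eq_abs] using this

lemma norm_Lp_rpow (hp : 1 < p) (f : Lp ℝ (ENNReal.ofReal p) ν) :
    ‖f‖ ^ p = ∫ x, |f x| ^ p ∂ν := by
  have hnn : 0 ≤ ∫ x, |f x| ^ p ∂ν := integral_nonneg fun x => by positivity
  rw [Lp.norm_def, eLpNorm_eq_ofReal_integral hp (Lp.memLp f), ENNReal.toReal_ofReal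
    (by positivity), ← Real.rpow_mul hnn, inv_mul_cancel₀ (by linarith), Real.rpow_one]

/-- Uniform convexity of `L^p`, in the form needed for minimization. -/
lemma norm_sub_rpow_le (hp : 1 < p) [Fact (1 ≤ ENNReal.ofReal p)] {ε C : ℝ}
    (h : ∀ a b : ℝ, |a - b| ^ p ≤
      ε * (|a| ^ p + |b| ^ p) + C * (|a| ^ p + |b| ^ p - 2 * |(a + b) / 2| ^ p))
    (f g : Lp ℝ (ENNReal.ofReal p) ν) :
    ‖f - g‖ ^ p ≤ ε * (‖f‖ ^ p + ‖g‖ ^ p) +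
      C * (‖f‖ ^ p + ‖g‖ ^ p - 2 * ‖(2⁻¹ : ℝ) • (f + g)‖ ^ p) := by
  simp only [norm_Lp_rpow hp]
  have i1 := integrable_abs_rpow hp (Lp.memLp f)
  have i2 := integrable_abs_rpow hp (Lp.memLp g)
  have i3 := integrable_abs_rpow hp (Lp.memLp ((2⁻¹ : ℝ) • (f + g)))
  have i4 := integrable_abs_rpow hp (Lp.memLp (f - g))
  have i12 : Integrable (fun x => |f x| ^ p + |g x| ^ p) ν := i1.add i2
  have i123 : Integrable (fun x => |f x| ^ p + |g x| ^ p -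
      2 * |((2⁻¹ : ℝ) • (f + g) : Lp ℝ (ENNReal.ofReal p) ν) x| ^ p) ν := i12.sub (i3.const_mul 2)
  rw [← integral_add i1 i2, ← integral_const_mul, ← integral_const_mul, ← integral_sub
    i12 (i3.const_mul 2), ← integral_const_mul, ← integral_add
    (i12.const_mul ε) (i123.const_mul C)]
  refine integral_mono_ae i4 ((i12.const_mul ε).add (i123.const_mul C)) ?_
  filter_upwards [Lp.coeFn_sub f g, Lp.coeFn_smul (2⁻¹ : ℝ) (f + g), Lp.coeFn_add f g]
    with x h1 h2 h3
  have := h (f x) (g x)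
  simp only [h1, h2, h3, Pi.add_apply, Pi.sub_apply, Pi.smul_apply, smul_eq_mul]
  rwa [div_eq_inv_mul] at this

/-- A closed subspace of `L^p` translated by `F` has an element of least norm. -/
lemma exists_norm_min (hp : 1 < p) [Fact (1 ≤ ENNReal.ofReal p)]
    (F : Lp ℝ (ENNReal.ofReal p) ν) (M : Submodule ℝ (Lp ℝ (ENNReal.ofReal p) ν))
    (hM : IsClosed (M : Set (Lp ℝ (ENNReal.ofReal p) ν))) :
    ∃ U, U - F ∈ M ∧ ∀ V ∈ M, ‖U‖ ≤ ‖U + V‖ := by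
  have hp0 : 0 < p := by linarith
  let S : Set ℝ := (fun m => ‖F + m‖) '' (M : Set (Lp ℝ (ENNReal.ofReal p) ν))
  have hS : S.Nonempty := ⟨_, 0, M.zero_mem, rfl⟩
  have hSb : BddBelow S := ⟨0, by rintro _ ⟨m, -, rfl⟩; exact norm_nonneg _⟩
  obtain ⟨d, hd⟩ : ∃ d, d = sInf S := ⟨_, rfl⟩
  have hd0 : 0 ≤ d := hd ▸ Real.sInf_nonneg (by rintro _ ⟨m, -, rfl⟩; exact norm_nonneg _)
  have hdle : ∀ m ∈ M, d ≤ ‖F + m‖ := fun m hm => hd ▸ csInf_le hSb ⟨m, hm, rfl⟩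
  obtain ⟨v, -, hv, hvS⟩ := exists_seq_tendsto_sInf hS hSb
  choose m hmM hmv using hvS
  rw [← hd] at hv
  have hlim : Tendsto (fun k => ‖F + m k‖ ^ p) atTop (𝓝 (d ^ p)) := by
    have : v = fun k => ‖F + m k‖ := funext fun k => (hmv k).symm
    rw [this] at hv
    exact hv.rpow_const (Or.inr hp0.le)
  have hcau : CauchySeq m := by
    rw [Metric.cauchySeq_iff]
    intro η hη
    have hη' : 0 < η ^ p := by positivity
    -- Chosen so that `2 ε d^p < η^p`; the summand `1` keeps the denominator positive when `d = 0`.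
    set ε := η ^ p / (2 * (d ^ p + d ^ p + 1)) with hε
    have hdp : 0 ≤ d ^ p := by positivity
    obtain ⟨C, hC0, hC⟩ := exists_abs_sub_rpow_le hp (ε := ε) (by positivity)
    have hlim2 : Tendsto (fun q : ℕ × ℕ => ε * (‖F + m q.1‖ ^ p + ‖F + m q.2‖ ^ p) +
        C * (‖F + m q.1‖ ^ p + ‖F + m q.2‖ ^ p - 2 * d ^ p)) atTop
        (𝓝 (ε * (d ^ p + d ^ p) + C * (d ^ p + d ^ p - 2 * d ^ p))) := by
      rw [← prod_atTop_atTop_eq]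
      have l1 := hlim.comp (tendsto_fst (f := (atTop : Filter ℕ)) (g := (atTop : Filter ℕ)))
      have l2 := hlim.comp (tendsto_snd (f := (atTop : Filter ℕ)) (g := (atTop : Filter ℕ)))
      exact ((l1.add l2).const_mul ε).add (((l1.add l2).sub_const _).const_mul C)
    have hlt : ε * (d ^ p + d ^ p) + C * (d ^ p + d ^ p - 2 * d ^ p) < η ^ p := by
      rw [show d ^ p + d ^ p - 2 * d ^ p = 0 by ring, mul_zero, add_zero, hε, div_mul_eq_mul_div,
        div_lt_iff₀ (by positivity)]
      nlinarith
    obtain ⟨⟨N₁, N₂⟩, hN⟩ := eventually_atTop.1 (hlim2.eventually (gt_mem_nhds hlt))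
    refine ⟨max N₁ N₂, fun k hk l hl => ?_⟩
    have h1 := hN (k, l) ⟨(le_max_left _ _).trans hk, (le_max_right _ _).trans hl⟩
    have h2 := norm_sub_rpow_le (ν := ν) hp hC (F + m k) (F + m l)
    -- The midpoint of two competitors is again a competitor, so the defect is at most an expression
    -- that tends to zero along the minimizing sequence.
    have h3 : d ^ p ≤ ‖(2⁻¹ : ℝ) • ((F + m k) + (F + m l))‖ ^ p := by
      refine Real.rpow_le_rpow hd0 ?_ hp0.le
      have e : (2⁻¹ : ℝ) • ((F + m k) + (F + m l)) = F + (2⁻¹ : ℝ) • (m k + m l) := by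
        module
      rw [e]
      exact hdle _ (M.smul_mem _ (M.add_mem (hmM k) (hmM l)))
    have h4 : C * (‖F + m k‖ ^ p + ‖F + m l‖ ^ p -
        2 * ‖(2⁻¹ : ℝ) • ((F + m k) + (F + m l))‖ ^ p) ≤
        C * (‖F + m k‖ ^ p + ‖F + m l‖ ^ p - 2 * d ^ p) := by gcongr
    rw [add_sub_add_left_eq_sub] at h2
    rw [dist_eq_norm]
    simp only at h1
    exact (Real.rpow_lt_rpow_iff (norm_nonneg _) hη.le hp0).1 (by linarith)
  obtain ⟨m₀, hm₀⟩ := cauchySeq_tendsto_of_complete hcau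
  have hm₀M : m₀ ∈ M := hM.mem_of_tendsto hm₀ (Eventually.of_forall hmM)
  have hnorm : ‖F + m₀‖ ^ p = d ^ p :=
    tendsto_nhds_unique ((hm₀.const_add F).norm.rpow_const (Or.inr hp0.le)) hlim
  have hnorm' : ‖F + m₀‖ = d := (Real.rpow_left_inj (norm_nonneg _) hd0 hp0.ne').1 hnorm
  refine ⟨F + m₀, by simpa using hm₀M, fun V hV => ?_⟩
  rw [hnorm', add_assoc]
  exact hdle _ (M.add_mem hm₀M hV)

/-- The tangent line at `U + tV`, evaluated at `U`, bounds `|U + tV|^p - |U|^p` above by `p t` times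
the duality pairing at `U + tV`. Minimality makes the integral of that pairing nonnegative for each
`t > 0`, and `t → 0` is taken by dominated convergence. The energy itself is never differentiated
under the integral. -/
lemma integral_dualityMap_mul_nonneg_of_min (hp : 1 < p) {U V : α → ℝ}
    (hU : MemLp U (ENNReal.ofReal p) ν) (hV : MemLp V (ENNReal.ofReal p) ν)
    (h : ∀ t : ℝ, 0 < t → ∫ x, |U x| ^ p ∂ν ≤ ∫ x, |U x + t * V x| ^ p ∂ν) :
    0 ≤ ∫ x, dualityMap p (U x) * V x ∂ν := by
  have hp0 : 0 < p := by linarith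
  have hUt : ∀ t : ℝ, MemLp (fun x => U x + t * V x) (ENNReal.ofReal p) ν := fun t =>
    hU.add (hV.const_mul t)
  have hpos : ∀ t : ℝ, 0 < t → 0 ≤ ∫ x, dualityMap p (U x + t * V x) * V x ∂ν := by
    intro t ht
    have i1 := integrable_abs_rpow hp hU
    have i2 := integrable_abs_rpow hp (hUt t)
    have i3 := integrable_dualityMap_mul hp (hUt t) hV
    have h1 : ∫ x, (|U x + t * V x| ^ p - p * t * (dualityMap p (U x + t * V x) * V x)) ∂ν ≤
        ∫ x, |U x| ^ p ∂ν := by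
      refine integral_mono (i2.sub (i3.const_mul (p * t))) i1 fun x => ?_
      have := abs_rpow_add_le hp (U x + t * V x) (U x)
      rw [sub_add_cancel_left] at this
      simp only
      linarith
    rw [integral_sub i2 (i3.const_mul (p * t)), integral_const_mul] at h1
    have h2 := h t ht
    have h3 : 0 ≤ p * t * ∫ x, dualityMap p (U x + t * V x) * V x ∂ν := by linarith
    exact nonneg_of_mul_nonneg_right h3 (by positivity)
  have hlim : Tendsto (fun t : ℝ => ∫ x, dualityMap p (U x + t * V x) * V x ∂ν) (𝓝[>] 0)
      (𝓝 (∫ x, dualityMap p (U x) * V x ∂ν)) := by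
    have hsum : MemLp (fun x => |U x| + |V x|) (ENNReal.ofReal p) ν := hU.abs.add hV.abs
    refine tendsto_integral_filter_of_dominated_convergence
      (fun x => |dualityMap p (|U x| + |V x|) * V x|) ?_ ?_
      (integrable_dualityMap_mul hp hsum hV).abs ?_
    · exact Eventually.of_forall fun t => (integrable_dualityMap_mul hp (hUt t) hV).1
    · filter_upwards [Ioo_mem_nhdsGT (zero_lt_one (α := ℝ))] with t ht
      refine Eventually.of_forall fun x => ?_
      rw [Real.norm_eq_abs, abs_mul, abs_mul, abs_dualityMap hp, abs_dualityMap hp]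
      have hle : |U x + t * V x| ≤ |(|U x| + |V x|)| := by
        rw [abs_of_nonneg (by positivity : 0 ≤ |U x| + |V x|)]
        refine (abs_add_le _ _).trans (add_le_add_right ?_ _)
        rw [abs_mul, abs_of_pos ht.1]
        exact mul_le_of_le_one_left (abs_nonneg _) ht.2.le
      exact mul_le_mul_of_nonneg_right (Real.rpow_le_rpow (abs_nonneg _) hle (by linarith))
        (abs_nonneg _)
    · refine Eventually.of_forall fun x => ?_
      have : Continuous fun t : ℝ => dualityMap p (U x + t * V x) * V x :=
        ((continuous_dualityMap hp).comp (by fun_prop)).mul continuous_const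
      simpa using (this.tendsto 0).mono_left nhdsWithin_le_nhds
  exact ge_of_tendsto hlim (eventually_mem_nhdsWithin.mono hpos)

/-- The Euler–Lagrange equation for the element of least `L^p` norm. -/
lemma integral_dualityMap_mul_eq_zero_of_min (hp : 1 < p) [Fact (1 ≤ ENNReal.ofReal p)]
    {U V : Lp ℝ (ENNReal.ofReal p) ν} (h : ∀ t : ℝ, ‖U‖ ≤ ‖U + t • V‖) :
    ∫ x, dualityMap p (U x) * V x ∂ν = 0 := by
  have hp0 : 0 < p := by linarith
  have key : ∀ t : ℝ, ∫ x, |U x| ^ p ∂ν ≤ ∫ x, |U x + t * V x| ^ p ∂ν := by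
    intro t
    have h1 := Real.rpow_le_rpow (norm_nonneg _) (h t) hp0.le
    rw [norm_Lp_rpow hp, norm_Lp_rpow hp] at h1
    refine h1.trans (le_of_eq (integral_congr_ae ?_))
    filter_upwards [Lp.coeFn_add U (t • V), Lp.coeFn_smul t V] with x h2 h3
    simp only [h2, h3, Pi.add_apply, Pi.smul_apply, smul_eq_mul]
  have h1 := integral_dualityMap_mul_nonneg_of_min hp (Lp.memLp U) (Lp.memLp V)
    fun t _ => key t
  have h2 := integral_dualityMap_mul_nonneg_of_min hp (Lp.memLp U) (Lp.memLp V).neg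
    fun t _ => by simpa using key (-t)
  simp only [Pi.neg_apply, mul_neg, integral_neg] at h2
  linarith

/-- `V ↦ ∫ |U|^(p-2) U V` is continuous along `L^p` convergent sequences. -/
lemma tendsto_integral_dualityMap_mul (hp : 1 < p) {U V : α → ℝ} {Vs : ℕ → α → ℝ}
    (hU : MemLp U (ENNReal.ofReal p) ν) (hV : MemLp V (ENNReal.ofReal p) ν)
    (hVs : ∀ k, MemLp (Vs k) (ENNReal.ofReal p) ν)
    (h : Tendsto (fun k => eLpNorm (Vs k - V) (ENNReal.ofReal p) ν) atTop (𝓝 0)) :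
    Tendsto (fun k => ∫ x, dualityMap p (U x) * Vs k x ∂ν) atTop
      (𝓝 (∫ x, dualityMap p (U x) * V x ∂ν)) := by
  have hpq := Real.HolderConjugate.conjExponent hp
  refine tendsto_integral_of_L1' _ (integrable_dualityMap_mul hp hU hV).1
    (Eventually.of_forall fun k => integrable_dualityMap_mul hp hU (hVs k)) ?_
  -- As `(p - 1) p' = p`, the duality map sends `L^p` into the conjugate space `L^{p'}`, and
  -- Hölder's inequality gives convergence in `L¹`.
  have hJ : eLpNorm (fun x => dualityMap p (U x)) (ENNReal.ofReal p.conjExponent) ν < ⊤ := by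
    rw [eLpNorm_lt_top_iff_lintegral_rpow_enorm_lt_top
      (ENNReal.ofReal_pos.2 hpq.symm.pos).ne' ENNReal.ofReal_ne_top,
      ENNReal.toReal_ofReal hpq.symm.nonneg]
    have h1 := hU.2
    rw [eLpNorm_lt_top_iff_lintegral_rpow_enorm_lt_top
      (ENNReal.ofReal_pos.2 hpq.pos).ne' ENNReal.ofReal_ne_top,
      ENNReal.toReal_ofReal hpq.nonneg] at h1
    refine lt_of_eq_of_lt (lintegral_congr fun x => ?_) h1
    rw [← ofReal_norm, ← ofReal_norm, Real.norm_eq_abs, Real.norm_eq_abs,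
      abs_dualityMap hp, ENNReal.ofReal_rpow_of_nonneg (by positivity) hpq.symm.nonneg,
      ENNReal.ofReal_rpow_of_nonneg (by positivity) hpq.nonneg, ← Real.rpow_mul (abs_nonneg _),
      Real.conjExponent, mul_div_cancel₀ _ (sub_ne_zero.2 hp.ne')]
  have hlim : Tendsto (fun k => eLpNorm (fun x => dualityMap p (U x))
      (ENNReal.ofReal p.conjExponent) ν * eLpNorm (Vs k - V) (ENNReal.ofReal p) ν) atTop
      (𝓝 0) := by
    simpa using ENNReal.Tendsto.const_mul h (Or.inr hJ.ne)
  have : ENNReal.HolderTriple (ENNReal.ofReal p.conjExponent) (ENNReal.ofReal p) 1 :=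
    hpq.symm.ennrealOfReal
  refine tendsto_of_tendsto_of_tendsto_of_le_of_le tendsto_const_nhds hlim
    (fun _ => zero_le) fun k => ?_
  have := eLpNorm_smul_le_mul_eLpNorm (p := ENNReal.ofReal p.conjExponent)
    (q := ENNReal.ofReal p) (r := 1) ((hVs k).1.sub hV.1)
    ((continuous_dualityMap hp).comp_aestronglyMeasurable hU.1)
  refine le_trans (le_of_eq (congrArg (eLpNorm · 1 ν) (funext fun x => ?_))) this
  simp only [Pi.smul_apply', Pi.sub_apply, smul_eq_mul, mul_sub]

end Lp

/-! ### The fractional gradient and the weighted measure `σ dμ` -/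

section Basic

variable {n : ℕ} {s p : ℝ}

lemma sGrad_add (s : ℝ) (u v : Rn n → ℝ) : sGrad s (u + v) = sGrad s u + sGrad s v := by
  ext z; simp only [sGrad, Pi.add_apply]; ring

lemma sGrad_sub (s : ℝ) (u v : Rn n → ℝ) : sGrad s (u - v) = sGrad s u - sGrad s v := by
  ext z; simp only [sGrad, Pi.sub_apply]; ring

lemma sGrad_smul (s c : ℝ) (u : Rn n → ℝ) : sGrad s (c • u) = c • sGrad s u := by
  ext z; simp only [sGrad, Pi.smul_apply, smul_eq_mul]; ring

/-- The measure `σ dμ`. -/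
noncomputable def weightedMeasure (σ : Rn n → Rn n → ℝ) : Measure (Rn n × Rn n) :=
  (offDiagMeasure n).withDensity fun z => ENNReal.ofReal (σ z.1 z.2)

/-- Uniform ellipticity with constant `lam`. -/
structure IsElliptic (lam : ℝ) (σ : Rn n → Rn n → ℝ) : Prop where
  aemeasurable : AEMeasurable (fun z : Rn n × Rn n => σ z.1 z.2) volume
  pos : 0 < lam
  le : ∀ x y, lam ≤ σ x y
  ge : ∀ x y, σ x y ≤ lam⁻¹

lemma offDiagMeasure_ac : offDiagMeasure n ≪ volume := withDensity_absolutelyContinuous _ _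

lemma weightedMeasure_ac (σ : Rn n → Rn n → ℝ) : weightedMeasure σ ≪ offDiagMeasure n :=
  withDensity_absolutelyContinuous _ _

lemma weightedMeasure_le {lam : ℝ} {σ : Rn n → Rn n → ℝ} (h : IsElliptic lam σ) :
    weightedMeasure σ ≤ ENNReal.ofReal lam⁻¹ • offDiagMeasure n := by
  rw [← withDensity_const]
  exact withDensity_mono (Eventually.of_forall fun z => ENNReal.ofReal_le_ofReal (h.ge _ _))

/-- Together with `weightedMeasure_le` this makes the `L^p` norms for `μ` and `σ μ` equivalent, so
convergence may be passed between them. -/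
lemma offDiagMeasure_le {lam : ℝ} {σ : Rn n → Rn n → ℝ} (h : IsElliptic lam σ) :
    offDiagMeasure n ≤ ENNReal.ofReal lam⁻¹ • weightedMeasure σ := by
  rw [weightedMeasure, ← withDensity_smul' _ _ ENNReal.ofReal_ne_top]
  conv_lhs => rw [← withDensity_one (μ := offDiagMeasure n)]
  refine withDensity_mono (Eventually.of_forall fun z => ?_)
  rw [Pi.one_apply, Pi.smul_apply, smul_eq_mul, ← ENNReal.ofReal_mul (inv_pos.2 h.pos).le,
    ENNReal.one_le_ofReal, ← div_eq_inv_mul, one_le_div h.pos]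
  exact h.le _ _

/-- The density of the Gagliardo energy with respect to Lebesgue measure. -/
noncomputable def gagliardoDensity (s p : ℝ) (u : Rn n → ℝ) (z : Rn n × Rn n) : ℝ≥0∞ :=
  ‖u z.1 - u z.2‖ₑ ^ p * ENNReal.ofReal ((‖z.1 - z.2‖ ^ (n + s * p))⁻¹)

lemma enorm_sGrad_rpow_mul (hs : 0 < s) (hp : 1 < p) (u : Rn n → ℝ) (z : Rn n × Rn n) :
    ENNReal.ofReal ((‖z.1 - z.2‖ ^ n)⁻¹) * ‖sGrad s u z‖ₑ ^ p = gagliardoDensity s p u z := by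
  have hp0 : 0 < p := by linarith
  -- A nonzero total exponent lets the power be split also on the diagonal, where the base is zero.
  have hsp : (n : ℝ) + s * p ≠ 0 := by positivity
  have hn := norm_nonneg (z.1 - z.2)
  rw [gagliardoDensity, sGrad, ← ofReal_norm, ← ofReal_norm, norm_div,
    Real.norm_of_nonneg (Real.rpow_nonneg hn s),
    ENNReal.ofReal_rpow_of_nonneg (by positivity) hp0.le,
    ENNReal.ofReal_rpow_of_nonneg (by positivity) hp0.le, ← ENNReal.ofReal_mul (by positivity),
    ← ENNReal.ofReal_mul (by positivity), Real.div_rpow (by positivity) (by positivity),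
    Real.rpow_add' hn hsp, Real.rpow_natCast, Real.rpow_mul hn, mul_inv]
  ring_nf

lemma measurable_offDiag : Measurable fun z : Rn n × Rn n =>
    ENNReal.ofReal ((‖z.1 - z.2‖ ^ n)⁻¹) := by fun_prop

lemma lintegral_weightedMeasure (hs : 0 < s) (hp : 1 < p) {lam : ℝ} {σ : Rn n → Rn n → ℝ}
    (h : IsElliptic lam σ) (u : Rn n → ℝ) :
    ∫⁻ z, ‖sGrad s u z‖ₑ ^ p ∂(weightedMeasure σ) =
      ∫⁻ z, ENNReal.ofReal (σ z.1 z.2) * gagliardoDensity s p u z := by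
  rw [weightedMeasure, lintegral_withDensity_eq_lintegral_mul_non_measurable₀ _
    (h.aemeasurable.ennreal_ofReal.mono_ac offDiagMeasure_ac)
    (Eventually.of_forall fun _ => ENNReal.ofReal_lt_top), offDiagMeasure,
    lintegral_withDensity_eq_lintegral_mul_non_measurable₀ _ measurable_offDiag.aemeasurable
    (Eventually.of_forall fun _ => ENNReal.ofReal_lt_top)]
  refine lintegral_congr fun z => ?_
  rw [← enorm_sGrad_rpow_mul hs hp]
  simp only [Pi.mul_apply]
  ring

lemma lintegral_offDiagMeasure (hs : 0 < s) (hp : 1 < p) (u : Rn n → ℝ) :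
    ∫⁻ z, ‖sGrad s u z‖ₑ ^ p ∂(offDiagMeasure n) = ∫⁻ z, gagliardoDensity s p u z := by
  rw [offDiagMeasure,
    lintegral_withDensity_eq_lintegral_mul_non_measurable₀ _ measurable_offDiag.aemeasurable
    (Eventually.of_forall fun _ => ENNReal.ofReal_lt_top)]
  exact lintegral_congr fun z => enorm_sGrad_rpow_mul hs hp u z

lemma eLpNorm_rpow {α : Type*} [MeasurableSpace α] (ν : Measure α) (hp : 1 < p) (u : α → ℝ) :
    eLpNorm u (ENNReal.ofReal p) ν ^ p = ∫⁻ x, ‖u x‖ₑ ^ p ∂ν := by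
  have hp0 : 0 < p := by linarith
  rw [eLpNorm_eq_lintegral_rpow_enorm_toReal (ENNReal.ofReal_pos.2 hp0).ne' ENNReal.ofReal_ne_top,
    ENNReal.toReal_ofReal hp0.le, ← ENNReal.rpow_mul, one_div, inv_mul_cancel₀ hp0.ne',
    ENNReal.rpow_one]

lemma aestronglyMeasurable_sGrad (s : ℝ) {u : Rn n → ℝ} (hu : AEStronglyMeasurable u volume) :
    AEStronglyMeasurable (sGrad s u) (offDiagMeasure n) := by
  refine AEStronglyMeasurable.mono_ac offDiagMeasure_ac ?_
  have h1 : AEStronglyMeasurable (fun z : Rn n × Rn n => u z.1)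
    ((volume : Measure (Rn n)).prod volume) := hu.comp_fst
  have h2 : AEStronglyMeasurable (fun z : Rn n × Rn n => u z.2)
    ((volume : Measure (Rn n)).prod volume) := hu.comp_snd
  have h3 : Measurable fun z : Rn n × Rn n => ‖z.1 - z.2‖ ^ s := by fun_prop
  exact ((h1.sub h2).aemeasurable.div h3.aemeasurable).aestronglyMeasurable

lemma MemW.memLp_sGrad {u : Rn n → ℝ} (hu : MemW s p u) :
    MemLp (sGrad s u) (ENNReal.ofReal p) (offDiagMeasure n) :=
  ⟨aestronglyMeasurable_sGrad s hu.1.1, hu.2⟩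

lemma MemW.memLp_sGrad_weighted {lam : ℝ} {σ : Rn n → Rn n → ℝ} (h : IsElliptic lam σ)
    {u : Rn n → ℝ} (hu : MemW s p u) :
    MemLp (sGrad s u) (ENNReal.ofReal p) (weightedMeasure σ) :=
  hu.memLp_sGrad.of_measure_le_smul ENNReal.ofReal_ne_top (weightedMeasure_le h)

lemma memW_iff {u : Rn n → ℝ} : MemW s p u ↔ MemLp u (ENNReal.ofReal p) volume ∧
    MemLp (sGrad s u) (ENNReal.ofReal p) (offDiagMeasure n) :=
  ⟨fun h => ⟨h.1, h.memLp_sGrad⟩, fun h => ⟨h.1, h.2.2⟩⟩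

lemma MemW.add {u v : Rn n → ℝ} (hu : MemW s p u) (hv : MemW s p v) : MemW s p (u + v) :=
  memW_iff.2 ⟨hu.1.add hv.1, sGrad_add s u v ▸ hu.memLp_sGrad.add hv.memLp_sGrad⟩

lemma MemW.sub {u v : Rn n → ℝ} (hu : MemW s p u) (hv : MemW s p v) : MemW s p (u - v) :=
  memW_iff.2 ⟨hu.1.sub hv.1, sGrad_sub s u v ▸ hu.memLp_sGrad.sub hv.memLp_sGrad⟩

/-- Absorbing `σ` into the measure turns the weak form into the duality pairing of a plain `L^p`
space, to which the abstract results apply. -/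
lemma weakForm_eq {lam : ℝ} {σ : Rn n → Rn n → ℝ} (h : IsElliptic lam σ) (u φ : Rn n → ℝ) :
    weakForm s p σ u φ =
      ∫ z, dualityMap p (sGrad s u z) * sGrad s φ z ∂(weightedMeasure σ) := by
  rw [weightedMeasure, integral_withDensity_eq_integral_toReal_smul₀
    (h.aemeasurable.ennreal_ofReal.mono_ac offDiagMeasure_ac)
    (Eventually.of_forall fun _ => ENNReal.ofReal_lt_top), weakForm]
  refine integral_congr_ae (Eventually.of_forall fun z => ?_)
  simp only [dualityMap, smul_eq_mul, ENNReal.toReal_ofReal (h.pos.le.trans (h.le z.1 z.2))]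
  ring

end Basic

/-! ### Test functions: finite energy and the Poincaré inequality -/

section Test

variable {n : ℕ} {s p : ℝ}

/-- The submodule of test functions supported in `U`. -/
def testFunctions (U : Set (Rn n)) : Submodule ℝ (Rn n → ℝ) where
  carrier := {φ | IsTestFunction U φ}
  zero_mem' := ⟨contDiff_const, HasCompactSupport.zero, by
    rw [show ((0 : Rn n → ℝ)) = fun _ => 0 from rfl]; simp [tsupport]⟩
  add_mem' := fun {φ ψ} h1 h2 => ⟨h1.1.add h2.1, h1.2.1.add h2.2.1,
    (tsupport_add φ ψ).trans (union_subset h1.2.2 h2.2.2)⟩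
  smul_mem' := fun c φ h => ⟨h.1.const_smul c, h.2.1.smul_left (f := fun _ => c),
    (tsupport_smul_subset_right (fun _ => c) φ).trans h.2.2⟩

lemma IsTestFunction.memLp {U : Set (Rn n)} {φ : Rn n → ℝ} (h : IsTestFunction U φ) (q : ℝ≥0∞) :
    MemLp φ q volume := h.1.continuous.memLp_of_hasCompactSupport h.2.1

lemma IsTestFunction.eq_zero {U : Set (Rn n)} {φ : Rn n → ℝ} (h : IsTestFunction U φ) {x : Rn n}
    (hx : x ∉ U) : φ x = 0 := image_eq_zero_of_notMem_tsupport fun h' => hx (h.2.2 h')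

/-- The radial majorant of the Gagliardo density is integrable. -/
lemma integrable_radial (hn : 1 ≤ n) (hs₀ : 0 < s) (hs₁ : s < 1) (hp : 1 < p) :
    Integrable fun x : Rn n => if ‖x‖ ≤ 1 then ‖x‖ ^ (p - (n + s * p)) else
      ‖x‖ ^ (-(n + s * p)) := by
  have hp0 : 0 < p := by linarith
  have : Nonempty (Fin n) := ⟨⟨0, hn⟩⟩
  have hkey := integrable_fun_norm_addHaar (volume : Measure (Rn n))
    (f := fun r : ℝ => if r ≤ 1 then r ^ (p - (n + s * p)) else r ^ (-(n + s * p)))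
  rw [hkey, finrank_euclideanSpace_fin, ← Ioc_union_Ioi_eq_Ioi zero_le_one]
  have hn1 : ((n - 1 : ℕ) : ℝ) = n - 1 := by push_cast [hn]; ring
  -- With the Jacobian `r^(n-1)`, the exponent near zero is `p - sp - 1 > -1` because `s < 1`, and
  -- the exponent at infinity is `-sp - 1 < -1` because `s > 0`.
  refine IntegrableOn.union ?_ ?_
  · have h1 : IntegrableOn (fun r : ℝ => r ^ (p - s * p - 1)) (Ioc 0 1) := by
      rw [← intervalIntegrable_iff_integrableOn_Ioc_of_le zero_le_one]
      exact intervalIntegral.intervalIntegrable_rpow' (by nlinarith)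
    refine h1.congr_fun (fun r hr => ?_) measurableSet_Ioc
    simp only [if_pos hr.2, smul_eq_mul]
    rw [← Real.rpow_natCast, ← Real.rpow_add hr.1, hn1]
    ring_nf
  · have h1 : IntegrableOn (fun r : ℝ => r ^ (-(s * p) - 1)) (Ioi 1) :=
      integrableOn_Ioi_rpow_of_lt (by nlinarith) one_pos
    refine h1.congr_fun (fun r hr => ?_) measurableSet_Ioi
    have hr' : (1 : ℝ) < r := hr
    simp only [if_neg hr'.not_ge, smul_eq_mul]
    rw [← Real.rpow_natCast, ← Real.rpow_add (by linarith), hn1]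
    ring_nf

/-- The Lipschitz bound controls the density for `|x - y| ≤ 1` and the sup bound controls it beyond,
both by the radial majorant of `x - y`. The density vanishes unless one of the points lies in the
compact support, so integrating first in the other variable gives a finite total. -/
lemma IsTestFunction.lintegral_gagliardoDensity_lt_top (hn : 1 ≤ n) (hs₀ : 0 < s) (hs₁ : s < 1)
    (hp : 1 < p) {U : Set (Rn n)} {φ : Rn n → ℝ} (h : IsTestFunction U φ) :
    ∫⁻ z, gagliardoDensity s p φ z < ⊤ := by
  have hp0 : 0 < p := by linarith
  obtain ⟨L, hL⟩ := h.1.lipschitzWith_of_hasCompactSupport h.2.1 (by simp)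
  obtain ⟨M, hM⟩ := h.2.1.exists_bound_of_continuous h.1.continuous
  set B := tsupport φ with hB
  have hBc : IsCompact B := h.2.1
  set g : Rn n → ℝ := fun x => if ‖x‖ ≤ 1 then ‖x‖ ^ (p - (n + s * p)) else
      ‖x‖ ^ (-(n + s * p)) with hg
  have hgm : Measurable g := by
    refine Measurable.ite (measurableSet_le measurable_norm measurable_const) ?_ ?_ <;> fun_prop
  have hgi : ∫⁻ x, ENNReal.ofReal (g x) < ⊤ := (integrable_radial hn hs₀ hs₁ hp).lintegral_lt_top
  set C : ℝ := (L : ℝ) ^ p + (2 * M) ^ p with hC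
  have hM0 : 0 ≤ M := (norm_nonneg _).trans (hM 0)
  have hC0 : 0 ≤ C := by positivity
  have hbound : ∀ x y, ‖φ x - φ y‖ₑ ^ p * ENNReal.ofReal ((‖x - y‖ ^ (n + s * p))⁻¹) ≤
      ENNReal.ofReal C * ENNReal.ofReal (g (x - y)) := by
    intro x y
    rw [← ofReal_norm, ENNReal.ofReal_rpow_of_nonneg (by positivity) hp0.le,
      ← ENNReal.ofReal_mul (by positivity), ← ENNReal.ofReal_mul hC0]
    apply ENNReal.ofReal_le_ofReal
    set r := ‖x - y‖ with hr
    have hr0 : 0 ≤ r := norm_nonneg _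
    rcases hr0.eq_or_lt with hr00 | hrpos
    · have : x = y := sub_eq_zero.1 (norm_eq_zero.1 (hr ▸ hr00.symm))
      subst this
      simp only [sub_self, norm_zero, Real.zero_rpow hp0.ne', zero_mul]
      apply mul_nonneg hC0
      simp only [hg]
      split_ifs <;> positivity
    · simp only [hg, ← hr]
      split_ifs with h1
      · have h2 : ‖φ x - φ y‖ ≤ L * r := by
          simpa [dist_eq_norm] using hL.dist_le_mul x y
        calc ‖φ x - φ y‖ ^ p * (r ^ (n + s * p))⁻¹ ≤ (L * r) ^ p * (r ^ (n + s * p))⁻¹ := by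
              gcongr
          _ = (L : ℝ) ^ p * r ^ (p - (n + s * p)) := by
              rw [Real.mul_rpow (by positivity) hr0, Real.rpow_sub hrpos, div_eq_mul_inv, mul_assoc]
          _ ≤ C * r ^ (p - (n + s * p)) := by
              gcongr
              exact le_add_of_nonneg_right (by positivity)
      · have h2 : ‖φ x - φ y‖ ≤ 2 * M := (norm_sub_le _ _).trans (by linarith [hM x, hM y])
        rw [Real.rpow_neg hr0]
        gcongr
        calc ‖φ x - φ y‖ ^ p ≤ (2 * M) ^ p := by gcongr
          _ ≤ C := le_add_of_nonneg_left (by positivity)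
  have hle : ∀ z : Rn n × Rn n, gagliardoDensity s p φ z ≤
      ENNReal.ofReal C * (B.indicator (fun _ => ENNReal.ofReal (g (z.1 - z.2))) z.1 +
        B.indicator (fun _ => ENNReal.ofReal (g (z.1 - z.2))) z.2) := by
    rintro ⟨x, y⟩
    simp only [gagliardoDensity]
    by_cases hx : x ∈ B
    · refine (hbound x y).trans ?_
      gcongr
      rw [indicator_of_mem hx]
      exact le_self_add
    · by_cases hy : y ∈ B
      · refine (hbound x y).trans ?_
        gcongr
        rw [indicator_of_mem hy]
        exact le_add_self
      · rw [image_eq_zero_of_notMem_tsupport hx, image_eq_zero_of_notMem_tsupport hy]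
        simp [hp0]
  have hm : Measurable fun z : Rn n × Rn n => ENNReal.ofReal (g (z.1 - z.2)) := by fun_prop
  have hBm : MeasurableSet B := hBc.isClosed.measurableSet
  have hm1 : Measurable fun z : Rn n × Rn n =>
      B.indicator (fun _ => ENNReal.ofReal (g (z.1 - z.2))) z.1 :=
    hm.indicator (measurable_fst hBm)
  have hm2 : Measurable fun z : Rn n × Rn n =>
      B.indicator (fun _ => ENNReal.ofReal (g (z.1 - z.2))) z.2 :=
    hm.indicator (measurable_snd hBm)
  refine (lintegral_mono hle).trans_lt ?_
  rw [lintegral_const_mul' _ _ ENNReal.ofReal_ne_top, lintegral_add_left hm1, Measure.volume_eq_prod,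
    lintegral_prod _ hm1.aemeasurable, lintegral_prod_symm _ hm2.aemeasurable]
  refine ENNReal.mul_lt_top ENNReal.ofReal_lt_top (ENNReal.add_lt_top.2 ⟨?_, ?_⟩)
  · have e : ∀ x : Rn n, ∫⁻ y, B.indicator (fun _ => ENNReal.ofReal (g (x - y))) x =
        B.indicator (fun _ => ∫⁻ x, ENNReal.ofReal (g x)) x := by
      intro x
      by_cases hx : x ∈ B
      · simp only [indicator_of_mem hx]
        exact lintegral_sub_left_eq_self (fun y => ENNReal.ofReal (g y)) x
      · simp [indicator_of_notMem hx]
    simp only [e]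
    rw [lintegral_indicator_const hBm]
    exact ENNReal.mul_lt_top hgi hBc.measure_lt_top
  · have e : ∀ y : Rn n, ∫⁻ x, B.indicator (fun _ => ENNReal.ofReal (g (x - y))) y =
        B.indicator (fun _ => ∫⁻ x, ENNReal.ofReal (g x)) y := by
      intro x
      by_cases hx : x ∈ B
      · simp only [indicator_of_mem hx]
        exact lintegral_sub_right_eq_self (fun y => ENNReal.ofReal (g y)) x
      · simp [indicator_of_notMem hx]
    simp only [e]
    rw [lintegral_indicator_const hBm]
    exact ENNReal.mul_lt_top hgi hBc.measure_lt_top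

lemma IsTestFunction.memW (hn : 1 ≤ n) (hs₀ : 0 < s) (hs₁ : s < 1)
    (hp : 1 < p) {U : Set (Rn n)} {φ : Rn n → ℝ} (h : IsTestFunction U φ) : MemW s p φ := by
  have hp0 : 0 < p := by linarith
  refine ⟨h.memLp _, ?_⟩
  have h1 := h.lintegral_gagliardoDensity_lt_top hn hs₀ hs₁ hp
  rw [← lintegral_offDiagMeasure hs₀ hp, ← eLpNorm_rpow _ hp] at h1
  exact (ENNReal.rpow_lt_top_iff_of_pos hp0).1 h1

/-- The fractional Poincaré inequality. -/
lemma exists_poincare (hn : 1 ≤ n) (hs₀ : 0 < s) (hp : 1 < p) {Ω : Set (Rn n)}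
    (hΩ : Bornology.IsBounded Ω) : ∃ C : ℝ≥0∞, C ≠ ⊤ ∧ ∀ φ : Rn n → ℝ,
      AEStronglyMeasurable φ volume → (∀ x ∉ Ω, φ x = 0) →
      ∫⁻ x, ‖φ x‖ₑ ^ p ≤ C * ∫⁻ z, ‖sGrad s φ z‖ₑ ^ p ∂(offDiagMeasure n) := by
  have hp0 : 0 < p := by linarith
  obtain ⟨R, hR0, hR⟩ := hΩ.subset_ball_lt 0 0
  -- The unit ball around `z₀` lies outside the ball of radius `R + 1`, so `φ` vanishes on it. Pairs
  -- in `Ω` times this ball have distance at most `D = 2R + 3`, and their share of the energy alone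
  -- dominates `‖φ‖_p^p`.
  set z₀ : Rn n := EuclideanSpace.single ⟨0, hn⟩ (R + 2) with hz₀
  have hz₀n : ‖z₀‖ = R + 2 := by
    rw [hz₀, PiLp.norm_single, Real.norm_of_nonneg (by linarith)]
  set D : ℝ := 2 * R + 3 with hD
  set c : ℝ≥0∞ := ENNReal.ofReal ((D ^ (n + s * p))⁻¹) with hc
  set b : ℝ≥0∞ := volume (Metric.ball z₀ 1) with hb
  have hc0 : c ≠ 0 := (ENNReal.ofReal_pos.2 (by positivity)).ne'
  have hb0 : b ≠ 0 := (Metric.measure_ball_pos volume z₀ one_pos).ne'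
  refine ⟨(c * b)⁻¹, ENNReal.inv_ne_top.2 (mul_ne_zero hc0 hb0), fun φ hφm hφ => ?_⟩
  have hcb : c * b ≠ ⊤ := ENNReal.mul_ne_top ENNReal.ofReal_ne_top measure_ball_lt_top.ne
  rw [← ENNReal.div_eq_inv_mul, ENNReal.le_div_iff_mul_le (Or.inl (mul_ne_zero hc0 hb0))
    (Or.inl hcb), lintegral_offDiagMeasure hs₀ hp]
  have hle : ∀ z : Rn n × Rn n, ‖φ z.1‖ₑ ^ p * (Metric.ball z₀ 1).indicator (fun _ => c) z.2 ≤
      gagliardoDensity s p φ z := by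
    rintro ⟨x, y⟩
    simp only [gagliardoDensity]
    by_cases hy : y ∈ Metric.ball z₀ 1
    · by_cases hx : x ∈ Ω
      · have hx' : ‖x‖ < R := by simpa using hR hx
        have hy' : ‖y - z₀‖ < 1 := by simpa [dist_eq_norm] using hy
        have h1 : R + 1 < ‖y‖ := by
          have := norm_sub_norm_le z₀ y
          rw [norm_sub_rev] at this
          linarith
        have h2 : ‖y‖ ≤ R + 3 := by
          have := norm_sub_norm_le y z₀
          linarith
        have hyΩ : y ∉ Ω := fun h => by
          have : ‖y‖ < R := by simpa using hR h
          linarith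
        rw [hφ y hyΩ, sub_zero, indicator_of_mem hy, hc]
        have h3 : 0 < ‖x - y‖ := by
          have := norm_sub_norm_le y x
          rw [norm_sub_rev] at this
          linarith
        have h4 : ‖x - y‖ ≤ D := (norm_sub_le x y).trans (by linarith)
        gcongr
      · rw [hφ x hx]
        simp [hp0]
    · simp [indicator_of_notMem hy]
  refine le_trans (le_of_eq ?_) (lintegral_mono hle)
  rw [Measure.volume_eq_prod, lintegral_prod_mul (f := fun x => ‖φ x‖ₑ ^ p)
    (hφm.enorm.pow_const p) (aemeasurable_const.indicator measurableSet_ball),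
    lintegral_indicator_const measurableSet_ball]

end Test

/-! ### Solvability of the Dirichlet problem and energy identities -/

section Existence

variable {n : ℕ} {s p : ℝ}

lemma exists_eLpNorm_le_weighted (p : ℝ) {lam : ℝ} {σ : Rn n → Rn n → ℝ} (h : IsElliptic lam σ) :
    ∃ K : ℝ≥0∞, K ≠ ⊤ ∧ ∀ w : Rn n × Rn n → ℝ, eLpNorm w (ENNReal.ofReal p) (offDiagMeasure n) ≤
      K * eLpNorm w (ENNReal.ofReal p) (weightedMeasure σ) := by
  refine ⟨ENNReal.ofReal lam⁻¹ ^ (1 / ENNReal.ofReal p).toReal,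
    ENNReal.rpow_ne_top_of_nonneg ENNReal.toReal_nonneg ENNReal.ofReal_ne_top, fun w => ?_⟩
  have := eLpNorm_mono_measure (p := ENNReal.ofReal p) w (offDiagMeasure_le h)
  rwa [eLpNorm_smul_measure_of_ne_top ENNReal.ofReal_ne_top, smul_eq_mul] at this

lemma tendsto_sGrad {u : ℕ → Rn n → ℝ} {v : Rn n → ℝ}
    (h : ∀ᵐ x, Tendsto (fun k => u k x) atTop (𝓝 (v x))) :
    ∀ᵐ z ∂(offDiagMeasure n), Tendsto (fun k => sGrad s (u k) z) atTop (𝓝 (sGrad s v z)) := by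
  refine offDiagMeasure_ac.ae_le ?_
  have h1 := (Measure.quasiMeasurePreserving_fst (μ := (volume : Measure (Rn n)))
    (ν := (volume : Measure (Rn n)))).ae h
  have h2 := (Measure.quasiMeasurePreserving_snd (μ := (volume : Measure (Rn n)))
    (ν := (volume : Measure (Rn n)))).ae h
  filter_upwards [h1, h2] with z hz1 hz2
  exact (hz1.sub hz2).div_const _

/-- Convergence in `L^p` implies almost everywhere convergence along a subsequence. -/
lemma exists_subseq_tendsto_ae {α : Type*} [MeasurableSpace α] {ν : Measure α}
    [Fact (1 ≤ ENNReal.ofReal p)] {f : ℕ → Lp ℝ (ENNReal.ofReal p) ν}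
    {g : Lp ℝ (ENNReal.ofReal p) ν} (h : Tendsto f atTop (𝓝 g)) :
    ∃ ns : ℕ → ℕ, StrictMono ns ∧ ∀ᵐ x ∂ν, Tendsto (fun k => f (ns k) x) atTop (𝓝 (g x)) :=
  (tendstoInMeasure_of_tendsto_Lp h).exists_seq_tendsto_ae

lemma tendsto_sobolevNorm_zero (hp : 1 < p) {u : ℕ → Rn n → ℝ}
    (h1 : Tendsto (fun k => eLpNorm (u k) (ENNReal.ofReal p) volume) atTop (𝓝 0))
    (h2 : Tendsto (fun k => gagliardoSeminorm s p (u k)) atTop (𝓝 0)) :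
    Tendsto (fun k => sobolevNorm s p (u k)) atTop (𝓝 0) := by
  have hp0 : 0 < p := by linarith
  have e1 := (ENNReal.continuous_rpow_const (y := p)).tendsto 0 |>.comp h1
  have e2 := (ENNReal.continuous_rpow_const (y := p)).tendsto 0 |>.comp h2
  have e3 := (ENNReal.continuous_rpow_const (y := 1 / p)).tendsto _ |>.comp (e1.add e2)
  simpa [hp0, ENNReal.zero_rpow_of_pos, sobolevNorm, Function.comp_def] using e3

/-- The Dirichlet problem is solvable. -/
lemma exists_isWeakSolution (hn : 1 ≤ n) (hs₀ : 0 < s) (hs₁ : s < 1) (hp : 1 < p)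
    {Ω : Set (Rn n)} (hΩ : Bornology.IsBounded Ω) {lam : ℝ} {σ : Rn n → Rn n → ℝ}
    (h : IsElliptic lam σ) {f : Rn n → ℝ} (hf : MemW s p f) :
    ∃ u, IsWeakSolution s p σ Ω f u := by
  have hp0 : 0 < p := by linarith
  have : Fact (1 ≤ ENNReal.ofReal p) := ⟨by rw [ENNReal.one_le_ofReal]; exact hp.le⟩
  have hW : ∀ φ : testFunctions Ω, MemW s p (φ : Rn n → ℝ) := fun φ =>
    IsTestFunction.memW hn hs₀ hs₁ hp φ.2
  let D : testFunctions Ω →ₗ[ℝ] Lp ℝ (ENNReal.ofReal p) (weightedMeasure σ) :=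
    { toFun := fun φ => ((hW φ).memLp_sGrad_weighted h).toLp
      map_add' := fun φ ψ => by
        rw [← MemLp.toLp_add]
        congr 1
        exact sGrad_add s (φ : Rn n → ℝ) (ψ : Rn n → ℝ)
      map_smul' := fun c φ => by
        rw [RingHom.id_apply, ← MemLp.toLp_const_smul]
        congr 1
        exact sGrad_smul s c (φ : Rn n → ℝ) }
  let I : testFunctions Ω →ₗ[ℝ] Lp ℝ (ENNReal.ofReal p) (volume : Measure (Rn n)) :=
    { toFun := fun φ => (hW φ).1.toLp
      map_add' := fun φ ψ => MemLp.toLp_add _ _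
      map_smul' := fun c φ => MemLp.toLp_const_smul c _ }
  have hD : ∀ φ, D φ =ᵐ[weightedMeasure σ] sGrad s (φ : Rn n → ℝ) := fun φ =>
    MemLp.coeFn_toLp ((hW φ).memLp_sGrad_weighted h)
  have hI : ∀ φ, I φ =ᵐ[volume] (φ : Rn n → ℝ) := fun φ => MemLp.coeFn_toLp (hW φ).1
  obtain ⟨K, hK, hKle⟩ := exists_eLpNorm_le_weighted p h
  obtain ⟨C, hC, hCle⟩ := exists_poincare hn hs₀ hp hΩ
  -- By Poincaré the gradient controls the function, so test functions whose gradients converge also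
  -- converge in `L^p`.
  obtain ⟨c, hc0, hc⟩ : ∃ c : ℝ, 0 ≤ c ∧ ∀ φ, ‖I φ‖ ≤ c * ‖D φ‖ := by
    refine ⟨(C ^ (1 / p) * K).toReal, ENNReal.toReal_nonneg, fun φ => ?_⟩
    have e1 := hCle φ (hW φ).1.1 fun x hx => IsTestFunction.eq_zero φ.2 hx
    rw [← eLpNorm_rpow _ hp, ← eLpNorm_rpow _ hp] at e1
    have e2 := ENNReal.rpow_le_rpow e1 (one_div_nonneg.2 hp0.le)
    rw [ENNReal.mul_rpow_of_nonneg _ _ (one_div_nonneg.2 hp0.le), ← ENNReal.rpow_mul,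
      ← ENNReal.rpow_mul, mul_one_div_cancel hp0.ne', ENNReal.rpow_one, ENNReal.rpow_one] at e2
    have e3 : eLpNorm (φ : Rn n → ℝ) (ENNReal.ofReal p) volume ≤
        C ^ (1 / p) * K * eLpNorm (sGrad s (φ : Rn n → ℝ)) (ENNReal.ofReal p) (weightedMeasure σ) := by
      rw [mul_assoc]
      exact e2.trans (mul_le_mul_right (hKle _) _)
    have e4 : ‖D φ‖ = (eLpNorm (sGrad s (φ : Rn n → ℝ)) (ENNReal.ofReal p) (weightedMeasure σ)).toReal :=
      Lp.norm_toLp _ ((hW φ).memLp_sGrad_weighted h)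
    have e5 : ‖I φ‖ = (eLpNorm (φ : Rn n → ℝ) (ENNReal.ofReal p) volume).toReal :=
      Lp.norm_toLp _ (hW φ).1
    rw [e4, e5, ← ENNReal.toReal_mul]
    refine ENNReal.toReal_mono (ENNReal.mul_ne_top (ENNReal.mul_ne_top
      (ENNReal.rpow_ne_top_of_nonneg (one_div_nonneg.2 hp0.le) hC) hK) ?_) e3
    exact ((hW φ).memLp_sGrad_weighted h).2.ne
  set F := (hf.memLp_sGrad_weighted h).toLp with hF
  -- `U` plays the role of the gradient of the solution; it remains to show that `U - F` is the
  -- gradient of some `v` in the closure of the test functions.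
  obtain ⟨U, hUF, hmin⟩ := exists_norm_min hp F D.range.topologicalClosure
    (Submodule.isClosed_topologicalClosure _)
  have hEL : ∀ φ, ∫ z, dualityMap p (U z) * D φ z ∂(weightedMeasure σ) = 0 := fun φ =>
    integral_dualityMap_mul_eq_zero_of_min hp fun t => hmin _
      (Submodule.le_topologicalClosure _ (Submodule.smul_mem _ t ⟨φ, rfl⟩))
  obtain ⟨g, hgmem, hglim⟩ := mem_closure_iff_seq_limit.1 hUF
  choose φ hφ using hgmem
  have hφlim : Tendsto (fun k => D (φ k)) atTop (𝓝 (U - F)) := by simpa only [hφ] using hglim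
  have hcau : CauchySeq fun k => I (φ k) := by
    have h1 := hφlim.cauchySeq
    rw [Metric.cauchySeq_iff] at h1 ⊢
    intro ε hε
    -- The denominator is `c + 1` because `c` may be zero.
    obtain ⟨N, hN⟩ := h1 (ε / (c + 1)) (by positivity)
    refine ⟨N, fun k hk l hl => ?_⟩
    have h2 := hN k hk l hl
    rw [dist_eq_norm, ← map_sub, lt_div_iff₀' (by positivity)] at h2
    rw [dist_eq_norm, ← map_sub]
    refine (hc _).trans_lt (lt_of_le_of_lt ?_ h2)
    gcongr
    linarith
  obtain ⟨v, hv⟩ := cauchySeq_tendsto_of_complete hcau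
  -- Along nested subsequences both the functions and their gradients converge almost everywhere;
  -- the pointwise limits then identify the gradient of `v` with `U - F`.
  obtain ⟨ns, hns, hae⟩ := exists_subseq_tendsto_ae hv
  obtain ⟨ms, hms, hae'⟩ := exists_subseq_tendsto_ae (hφlim.comp hns.tendsto_atTop)
  have hvG : sGrad s v =ᵐ[weightedMeasure σ] (U - F : Lp ℝ (ENNReal.ofReal p) (weightedMeasure σ)) := by
    have h1 : ∀ᵐ x, Tendsto (fun k => (φ (ns k) : Rn n → ℝ) x) atTop (𝓝 (v x)) := by
      filter_upwards [hae, ae_all_iff.2 fun k => hI (φ k)] with x hx hx'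
      simpa only [hx'] using hx
    have h2 := (weightedMeasure_ac σ).ae_le (tendsto_sGrad (s := s) h1)
    filter_upwards [h2, hae', ae_all_iff.2 fun k => hD (φ k)] with z hz1 hz2 hz3
    simp only [Function.comp_apply, hz3] at hz2
    exact tendsto_nhds_unique (hz1.comp hms.tendsto_atTop) hz2
  have hvW : MemW s p v := by
    refine memW_iff.2 ⟨Lp.memLp v, ?_⟩
    exact ((memLp_congr_ae hvG).2 (Lp.memLp (U - F))).of_measure_le_smul ENNReal.ofReal_ne_top
      (offDiagMeasure_le h)
  have hvT : MemWTilde s p Ω v := by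
    refine ⟨hvW, fun ε hε => ?_⟩
    have hlim : Tendsto (fun k => sobolevNorm s p ((v : Rn n → ℝ) - (φ k : Rn n → ℝ))) atTop (𝓝 0) := by
      refine tendsto_sobolevNorm_zero hp ?_ ?_
      · have h1 := (tendsto_iff_edist_tendsto_0.1 hv)
        refine h1.congr fun k => ?_
        rw [edist_comm, Lp.edist_def]
        refine eLpNorm_congr_ae ?_
        filter_upwards [hI (φ k)] with x hx
        simp [hx]
      · have h1 := (tendsto_iff_edist_tendsto_0.1 hφlim)
        have h2 : Tendsto (fun k => K * edist (D (φ k)) (U - F)) atTop (𝓝 0) := by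
          simpa using ENNReal.Tendsto.const_mul h1 (Or.inr hK)
        refine tendsto_of_tendsto_of_tendsto_of_le_of_le tendsto_const_nhds h2
          (fun _ => zero_le) fun k => ?_
        refine (hKle _).trans (mul_le_mul_right (le_of_eq ?_) _)
        rw [edist_comm, Lp.edist_def]
        refine eLpNorm_congr_ae ?_
        filter_upwards [hD (φ k), hvG] with z hz hz'
        simp only [sGrad_sub, Pi.sub_apply, hz, hz']
    obtain ⟨k, hk⟩ := (hlim.eventually (gt_mem_nhds hε)).exists
    exact ⟨φ k, (φ k).2, hk⟩
  refine ⟨f + v, hf.add hvW, fun ψ hψ => ?_, by rwa [add_sub_cancel_left]⟩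
  rw [weakForm_eq h, ← hEL ⟨ψ, hψ⟩]
  refine integral_congr_ae ?_
  filter_upwards [hvG, hD ⟨ψ, hψ⟩, MemLp.coeFn_toLp (hf.memLp_sGrad_weighted h),
    Lp.coeFn_sub U F] with z h1 h2 h3 h4
  rw [h2, sGrad_add, Pi.add_apply, h1, h4, Pi.sub_apply, h3, add_sub_cancel]

/-- The energy `∫ σ |d_s u|^p dμ`. -/
noncomputable def energy (s p : ℝ) (σ : Rn n → Rn n → ℝ) (u : Rn n → ℝ) : ℝ≥0∞ :=
  ∫⁻ z, ‖sGrad s u z‖ₑ ^ p ∂(weightedMeasure σ)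

lemma energy_eq_ofReal (hp : 1 < p) {lam : ℝ} {σ : Rn n → Rn n → ℝ} (h : IsElliptic lam σ)
    {u : Rn n → ℝ} (hu : MemW s p u) :
    energy s p σ u = ENNReal.ofReal (∫ z, |sGrad s u z| ^ p ∂(weightedMeasure σ)) := by
  have hp0 : 0 < p := by linarith
  rw [ofReal_integral_eq_lintegral_ofReal (integrable_abs_rpow hp (hu.memLp_sGrad_weighted h))
    (Eventually.of_forall fun z => by positivity), energy]
  refine lintegral_congr fun z => ?_
  rw [← ofReal_norm, ENNReal.ofReal_rpow_of_nonneg (norm_nonneg _) hp0.le, Real.norm_eq_abs]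

/-- The weak equation may be tested with elements of the closure of `C_c^∞(Ω)`. -/
lemma IsWeakSolution.weakForm_eq_zero (hn : 1 ≤ n) (hs₀ : 0 < s) (hs₁ : s < 1) (hp : 1 < p)
    {Ω : Set (Rn n)} {lam : ℝ} {σ : Rn n → Rn n → ℝ}
    (h : IsElliptic lam σ) {f u v : Rn n → ℝ} (hu : IsWeakSolution s p σ Ω f u)
    (hv : MemWTilde s p Ω v) : weakForm s p σ u v = 0 := by
  have hp0 : 0 < p := by linarith
  choose φ hφ hlt using fun k : ℕ => hv.2 ((k : ℝ≥0∞) + 1)⁻¹ (by simp)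
  have hW : ∀ k, MemW s p (φ k) := fun k => (hφ k).memW hn hs₀ hs₁ hp
  have hle : ∀ k, eLpNorm (sGrad s (φ k) - sGrad s v) (ENNReal.ofReal p) (weightedMeasure σ) ≤
      ENNReal.ofReal lam⁻¹ ^ (1 / ENNReal.ofReal p).toReal * ((k : ℝ≥0∞) + 1)⁻¹ := by
    intro k
    have h1 := eLpNorm_mono_measure (p := ENNReal.ofReal p) (sGrad s (φ k) - sGrad s v)
      (weightedMeasure_le h)
    rw [eLpNorm_smul_measure_of_ne_top ENNReal.ofReal_ne_top, smul_eq_mul] at h1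
    refine h1.trans (mul_le_mul_right (le_trans ?_ (hlt k).le) _)
    rw [eLpNorm_sub_comm, ← sGrad_sub, sobolevNorm]
    calc gagliardoSeminorm s p (v - φ k) = (gagliardoSeminorm s p (v - φ k) ^ p) ^ (1 / p) := by
          rw [← ENNReal.rpow_mul, mul_one_div_cancel hp0.ne', ENNReal.rpow_one]
      _ ≤ _ := ENNReal.rpow_le_rpow le_add_self (one_div_nonneg.2 hp0.le)
  have hlim := tendsto_integral_dualityMap_mul hp (hu.memW.memLp_sGrad_weighted h)
    (hv.1.memLp_sGrad_weighted h) (fun k => (hW k).memLp_sGrad_weighted h) (by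
      refine tendsto_of_tendsto_of_tendsto_of_le_of_le tendsto_const_nhds ?_
        (fun _ => zero_le) hle
      have h0 : Tendsto (fun k : ℕ => ((k : ℝ≥0∞) + 1)⁻¹) atTop (𝓝 0) := by
        have := ENNReal.tendsto_inv_nat_nhds_zero.comp (tendsto_add_atTop_nat 1)
        simpa [Function.comp_def] using this
      simpa using ENNReal.Tendsto.const_mul h0 (Or.inr
        (ENNReal.rpow_ne_top_of_nonneg (ENNReal.toReal_nonneg (a := 1 / ENNReal.ofReal p))
          (ENNReal.ofReal_ne_top (r := lam⁻¹)))))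
  simp only [← weakForm_eq h, hu.eq_zero _ (hφ _)] at hlim
  exact (tendsto_nhds_unique hlim tendsto_const_nhds)

/-- The difference `u - f` may be used as a test function, so pairing with `f` equals pairing with
`u`, which is the energy. -/
lemma IsWeakSolution.weakForm_self (hn : 1 ≤ n) (hs₀ : 0 < s) (hs₁ : s < 1) (hp : 1 < p)
    {Ω : Set (Rn n)} {lam : ℝ} {σ : Rn n → Rn n → ℝ}
    (h : IsElliptic lam σ) {f u : Rn n → ℝ} (hu : IsWeakSolution s p σ Ω f u) (hf : MemW s p f) :
    weakForm s p σ u f = ∫ z, |sGrad s u z| ^ p ∂(weightedMeasure σ) := by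
  have h1 := hu.weakForm_eq_zero hn hs₀ hs₁ hp h hu.exterior_value
  rw [weakForm_eq h, sGrad_sub] at h1
  simp only [Pi.sub_apply, mul_sub, dualityMap_mul_self hp] at h1
  rw [integral_sub (integrable_abs_rpow hp (hu.memW.memLp_sGrad_weighted h))
    (integrable_dualityMap_mul hp (hu.memW.memLp_sGrad_weighted h) (hf.memLp_sGrad_weighted h))] at h1
  rw [weakForm_eq h]
  linarith

/-- Young's inequality applied to `E(u) = ∫ σ |d_s u|^{p-2} d_s u d_s f dμ` gives `p E(u) ≤ (p - 1)
E(u) + E(f)`. -/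
lemma IsWeakSolution.energy_le (hn : 1 ≤ n) (hs₀ : 0 < s) (hs₁ : s < 1) (hp : 1 < p)
    {Ω : Set (Rn n)} {lam : ℝ} {σ : Rn n → Rn n → ℝ}
    (h : IsElliptic lam σ) {f u : Rn n → ℝ} (hu : IsWeakSolution s p σ Ω f u) (hf : MemW s p f) :
    energy s p σ u ≤ energy s p σ f := by
  rw [energy_eq_ofReal hp h hu.memW, energy_eq_ofReal hp h hf]
  apply ENNReal.ofReal_le_ofReal
  have hU := hu.memW.memLp_sGrad_weighted h
  have hF := hf.memLp_sGrad_weighted h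
  have h1 := hu.weakForm_self hn hs₀ hs₁ hp h hf
  rw [weakForm_eq h] at h1
  have h2 : ∫ z, p * (dualityMap p (sGrad s u z) * sGrad s f z) ∂(weightedMeasure σ) ≤
      ∫ z, ((p - 1) * |sGrad s u z| ^ p + |sGrad s f z| ^ p) ∂(weightedMeasure σ) :=
    integral_mono ((integrable_dualityMap_mul hp hU hF).const_mul p)
      (((integrable_abs_rpow hp hU).const_mul (p - 1)).add (integrable_abs_rpow hp hF))
      fun z => mul_dualityMap_mul_le hp _ _
  rw [integral_const_mul, h1, integral_add ((integrable_abs_rpow hp hU).const_mul (p - 1))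
    (integrable_abs_rpow hp hF), integral_const_mul] at h2
  linarith

/-- Elements of the closure of `C_c^∞(Ω)` vanish outside `Ω`. -/
lemma MemWTilde.ae_eq_zero (hp : 1 < p) {Ω : Set (Rn n)} (hΩ : MeasurableSet Ω) {v : Rn n → ℝ}
    (hv : MemWTilde s p Ω v) : ∀ᵐ x, x ∉ Ω → v x = 0 := by
  have hp0 : 0 < p := by linarith
  have h0 : eLpNorm v (ENNReal.ofReal p) (volume.restrict Ωᶜ) = 0 := by
    -- Test functions vanish off `Ω`, so there the `L^p` norm of `v` equals that of `v - φ`, which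
    -- is arbitrarily small.
    refine le_antisymm (le_of_forall_pos_le_add fun ε hε => ?_) zero_le
    rw [zero_add]
    obtain ⟨φ, hφ, hlt⟩ := hv.2 ε hε
    have h1 : eLpNorm v (ENNReal.ofReal p) (volume.restrict Ωᶜ) =
        eLpNorm (v - φ) (ENNReal.ofReal p) (volume.restrict Ωᶜ) := by
      refine eLpNorm_congr_ae ?_
      filter_upwards [ae_restrict_mem hΩ.compl] with x hx
      simp [hφ.eq_zero hx]
    rw [h1]
    refine (eLpNorm_mono_measure _ Measure.restrict_le_self).trans (le_trans ?_ hlt.le)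
    calc eLpNorm (v - φ) (ENNReal.ofReal p) volume =
          (eLpNorm (v - φ) (ENNReal.ofReal p) volume ^ p) ^ (1 / p) := by
          rw [← ENNReal.rpow_mul, mul_one_div_cancel hp0.ne', ENNReal.rpow_one]
      _ ≤ _ := ENNReal.rpow_le_rpow le_self_add (one_div_nonneg.2 hp0.le)
  rw [eLpNorm_eq_zero_iff hv.1.1.1.restrict (ENNReal.ofReal_pos.2 hp0).ne'] at h0
  exact (ae_restrict_iff' hΩ.compl).1 h0

end Existence

/-! ### Comparing the energies of `f` and `u_f` -/

section Comparison

variable {n : ℕ} {s p : ℝ}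

/-- Changing `f` inside `Ω`, away from its support, lowers the energy at most by a multiple of
`‖f‖_p^p`. -/
lemma energy_le_energy_add (hs₀ : 0 < s) (hp : 1 < p) {lam : ℝ} {σ : Rn n → Rn n → ℝ}
    (h : IsElliptic lam σ) {Ω B : Set (Rn n)} (hΩ : MeasurableSet Ω) {r : ℝ} (hr : 0 < r)
    (hΩB : ∀ x ∈ Ω, ∀ y ∈ B, r ≤ ‖x - y‖) {f u : Rn n → ℝ} (hfc : AEStronglyMeasurable f volume)
    (hf : ∀ x ∉ B, f x = 0) (huf : ∀ᵐ x, x ∉ Ω → u x = f x) :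
    energy s p σ f ≤ energy s p σ u +
      2 * (ENNReal.ofReal lam⁻¹ * ENNReal.ofReal ((r ^ (n + s * p))⁻¹) * volume Ω) *
        ∫⁻ x, ‖f x‖ₑ ^ p := by
  have hp0 : 0 < p := by linarith
  set K := ENNReal.ofReal lam⁻¹ * ENNReal.ofReal ((r ^ (n + s * p))⁻¹) with hK
  have hfΩ : ∀ x ∈ Ω, f x = 0 := fun x hx => hf x fun hxB => by
    have := hΩB x hx x hxB
    rw [sub_self, norm_zero] at this
    linarith
  have hσ : ∀ x y, ENNReal.ofReal (σ x y) ≤ ENNReal.ofReal lam⁻¹ := fun x y =>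
    ENNReal.ofReal_le_ofReal (h.ge x y)
  have hcross : ∀ x ∈ Ω, ∀ y, ‖f y‖ₑ ^ p * ENNReal.ofReal ((‖x - y‖ ^ (n + s * p))⁻¹) ≤
      ENNReal.ofReal ((r ^ (n + s * p))⁻¹) * ‖f y‖ₑ ^ p := by
    intro x hx y
    by_cases hy : y ∈ B
    · rw [mul_comm]
      gcongr
      exact hΩB x hx y hy
    · simp [hf y hy, hp0]
  -- When one point lies in `Ω`, `f` vanishes there, the energy density of `u` is discarded, and the
  -- distance `r` removes the singularity of the kernel. When neither does, the densities of `f` and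
  -- `u` agree.
  have hpt : ∀ᵐ z : Rn n × Rn n, ENNReal.ofReal (σ z.1 z.2) * gagliardoDensity s p f z ≤
      ENNReal.ofReal (σ z.1 z.2) * gagliardoDensity s p u z +
        (K * (Ω.indicator (fun _ => 1) z.1 * ‖f z.2‖ₑ ^ p) +
          K * (‖f z.1‖ₑ ^ p * Ω.indicator (fun _ => 1) z.2)) := by
    have h1 := (Measure.quasiMeasurePreserving_fst (μ := (volume : Measure (Rn n)))
      (ν := (volume : Measure (Rn n)))).ae huf
    have h2 := (Measure.quasiMeasurePreserving_snd (μ := (volume : Measure (Rn n)))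
      (ν := (volume : Measure (Rn n)))).ae huf
    filter_upwards [h1, h2] with z hz1 hz2
    obtain ⟨x, y⟩ := z
    simp only [gagliardoDensity] at hz1 hz2 ⊢
    by_cases hx : x ∈ Ω
    · refine le_trans ?_ (le_add_self.trans' le_self_add)
      rw [hfΩ x hx, zero_sub, enorm_neg, indicator_of_mem hx, one_mul, hK, mul_assoc]
      exact mul_le_mul' (hσ x y) (hcross x hx y)
    · by_cases hy : y ∈ Ω
      · refine le_trans ?_ (le_add_self.trans' le_add_self)
        rw [hfΩ y hy, sub_zero, indicator_of_mem hy, mul_one, hK, mul_assoc, norm_sub_rev]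
        exact mul_le_mul' (hσ x y) (hcross y hy x)
      · rw [hz1 hx, hz2 hy]
        exact le_self_add
  have hm0 : AEMeasurable (fun x => ‖f x‖ₑ ^ p) volume := hfc.enorm.pow_const p
  have hm1 : AEMeasurable (Ω.indicator (fun _ => (1 : ℝ≥0∞))) (volume : Measure (Rn n)) :=
    aemeasurable_const.indicator hΩ
  have hm2 : AEMeasurable (fun z : Rn n × Rn n => K * (Ω.indicator (fun _ => 1) z.1 * ‖f z.2‖ₑ ^ p))
      ((volume : Measure (Rn n)).prod volume) :=
    ((hm1.comp_fst).mul hm0.comp_snd).const_mul K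
  have hm3 : AEMeasurable (fun z : Rn n × Rn n => K * (‖f z.1‖ₑ ^ p * Ω.indicator (fun _ => 1) z.2))
      ((volume : Measure (Rn n)).prod volume) :=
    ((hm0.comp_fst).mul hm1.comp_snd).const_mul K
  have hKtop : K ≠ ⊤ := ENNReal.mul_ne_top ENNReal.ofReal_ne_top ENNReal.ofReal_ne_top
  rw [energy, energy, lintegral_weightedMeasure hs₀ hp h, lintegral_weightedMeasure hs₀ hp h]
  refine (lintegral_mono_ae hpt).trans (le_of_eq ?_)
  have hm23 : AEMeasurable (fun z : Rn n × Rn n => K * (Ω.indicator (fun _ => 1) z.1 * ‖f z.2‖ₑ ^ p) +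
      K * (‖f z.1‖ₑ ^ p * Ω.indicator (fun _ => 1) z.2)) volume := hm2.add hm3
  rw [lintegral_add_right' _ hm23]
  congr 1
  rw [Measure.volume_eq_prod, lintegral_add_left' hm2, lintegral_const_mul' _ _ hKtop,
    lintegral_const_mul' _ _ hKtop, lintegral_prod_mul hm1 hm0, lintegral_prod_mul hm0 hm1,
    lintegral_indicator_const hΩ]
  ring

/-- This is how the boundary data enter: the diagonal of the form determines the energy of the
solution. Existence guarantees that the choice made in `solution` is a genuine weak solution. -/
lemma dnMap_self (hn : 1 ≤ n) (hs₀ : 0 < s) (hs₁ : s < 1) (hp : 1 < p)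
    {Ω : Set (Rn n)} (hΩ : Bornology.IsBounded Ω) {lam : ℝ} {σ : Rn n → Rn n → ℝ}
    (h : IsElliptic lam σ) {f : Rn n → ℝ} (hf : MemW s p f) :
    energy s p σ (solution s p σ Ω f) = ENNReal.ofReal (dnMap s p σ Ω f f) := by
  have hu : IsWeakSolution s p σ Ω f (solution s p σ Ω f) :=
    Classical.epsilon_spec (exists_isWeakSolution hn hs₀ hs₁ hp hΩ h hf)
  rw [energy_eq_ofReal hp h hu.memW, dnMap, hu.weakForm_self hn hs₀ hs₁ hp h hf]

/-- If the Dirichlet-to-Neumann data of `f` agree then so do the energies of `f`, up to a multiple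
of `‖f‖_p^p`. -/
lemma energy_le_of_dnMap_eq (hn : 1 ≤ n) (hs₀ : 0 < s) (hs₁ : s < 1) (hp : 1 < p)
    {Ω B : Set (Rn n)} (hΩ : Bornology.IsBounded Ω) (hΩm : MeasurableSet Ω) {lam₁ lam₂ : ℝ}
    {σ₁ σ₂ : Rn n → Rn n → ℝ} (h₁ : IsElliptic lam₁ σ₁) (h₂ : IsElliptic lam₂ σ₂) {r : ℝ}
    (hr : 0 < r) (hΩB : ∀ x ∈ Ω, ∀ y ∈ B, r ≤ ‖x - y‖) {f : Rn n → ℝ}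
    (hf : IsTestFunction B f) (hΛ : dnMap s p σ₁ Ω f f = dnMap s p σ₂ Ω f f) :
    energy s p σ₁ f ≤ energy s p σ₂ f +
      2 * (ENNReal.ofReal lam₁⁻¹ * ENNReal.ofReal ((r ^ (n + s * p))⁻¹) * volume Ω) *
        ∫⁻ x, ‖f x‖ₑ ^ p := by
  have hfW : MemW s p f := hf.memW hn hs₀ hs₁ hp
  have hu₁ : IsWeakSolution s p σ₁ Ω f (solution s p σ₁ Ω f) :=
    Classical.epsilon_spec (exists_isWeakSolution hn hs₀ hs₁ hp hΩ h₁ hfW)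
  have hu₂ : IsWeakSolution s p σ₂ Ω f (solution s p σ₂ Ω f) :=
    Classical.epsilon_spec (exists_isWeakSolution hn hs₀ hs₁ hp hΩ h₂ hfW)
  have hE : energy s p σ₁ (solution s p σ₁ Ω f) = energy s p σ₂ (solution s p σ₂ Ω f) := by
    rw [dnMap_self hn hs₀ hs₁ hp hΩ h₁ hfW, dnMap_self hn hs₀ hs₁ hp hΩ h₂ hfW, hΛ]
  have hle := hu₂.energy_le hn hs₀ hs₁ hp h₂ hfW
  rw [← hE] at hle
  refine (energy_le_energy_add hs₀ hp h₁ hΩm hr hΩB hfW.1.1 (fun x hx => hf.eq_zero hx) ?_).trans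
    (add_le_add_left hle _)
  filter_upwards [hu₁.exterior_value.ae_eq_zero hp hΩm] with x hx hxΩ
  exact sub_eq_zero.1 (hx hxΩ)

end Comparison

/-! ### Concentration at a point of the diagonal -/

section Scaling

variable {n : ℕ} {s p : ℝ}

instance isAddHaarMeasure_volume_prod : (volume : Measure (Rn n × Rn n)).IsAddHaarMeasure :=
  inferInstanceAs ((volume : Measure (Rn n)).prod (volume : Measure (Rn n))).IsAddHaarMeasure

lemma quasiMeasurePreserving_affine {E : Type*} [NormedAddCommGroup E] [NormedSpace ℝ E]
    [MeasurableSpace E] [BorelSpace E] [FiniteDimensional ℝ E] (μ : Measure E) [μ.IsAddHaarMeasure]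
    (a : E) {r : ℝ} (hr : r ≠ 0) : Measure.QuasiMeasurePreserving (fun w => a + r • w) μ μ := by
  have h1 : Measure.QuasiMeasurePreserving (fun w : E => r • w) μ μ := by
    refine ⟨measurable_const_smul r, ?_⟩
    rw [show (fun w : E => r • w) = (r • ·) from rfl, Measure.map_addHaar_smul μ hr]
    exact Measure.smul_absolutelyContinuous
  exact (measurePreserving_add_left μ a).quasiMeasurePreserving.comp h1

lemma lintegral_comp_smul_sub {E : Type*} [NormedAddCommGroup E] [NormedSpace ℝ E]
    [MeasurableSpace E] [BorelSpace E] [FiniteDimensional ℝ E] (μ : Measure E) [μ.IsAddHaarMeasure]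
    (G : E → ℝ≥0∞) (a : E) {r : ℝ} (hr : 0 < r) :
    ∫⁻ z, G (r • (z - a)) ∂μ =
      ENNReal.ofReal ((r ^ Module.finrank ℝ E)⁻¹) * ∫⁻ w, G w ∂μ := by
  rw [lintegral_sub_right_eq_self (fun z => G (r • z)) a]
  have h1 := (Homeomorph.smulOfNeZero r hr.ne').measurableEmbedding.lintegral_map (μ := μ) G
  have h2 : Measure.map (Homeomorph.smulOfNeZero r hr.ne' : E → E) μ =
      ENNReal.ofReal ((r ^ Module.finrank ℝ E)⁻¹) • μ := by
    have := Measure.map_addHaar_smul μ hr.ne'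
    rwa [abs_of_pos (by positivity)] at this
  rw [h2, lintegral_smul_measure] at h1
  exact h1.symm

/-- The function `η` concentrated at `x₀` on the scale `k⁻¹`. -/
def concentrate (η : Rn n → ℝ) (x₀ : Rn n) (k : ℝ) (x : Rn n) : ℝ := η (k • (x - x₀))

lemma lintegral_concentrate (η : Rn n → ℝ) (x₀ : Rn n) {k : ℝ} (hk : 0 < k) :
    ∫⁻ x, ‖concentrate η x₀ k x‖ₑ ^ p = ENNReal.ofReal ((k ^ n)⁻¹) * ∫⁻ x, ‖η x‖ₑ ^ p := by
  have := lintegral_comp_smul_sub volume (fun x => ‖η x‖ₑ ^ p) x₀ hk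
  rwa [finrank_euclideanSpace_fin] at this

lemma gagliardoDensity_concentrate (η : Rn n → ℝ) (x₀ : Rn n) {k : ℝ} (hk : 0 < k)
    (z : Rn n × Rn n) : gagliardoDensity s p (concentrate η x₀ k) z =
      ENNReal.ofReal (k ^ (n + s * p)) * gagliardoDensity s p η (k • (z - (x₀, x₀))) := by
  have h1 : ‖k • (z.1 - x₀) - k • (z.2 - x₀)‖ = k * ‖z.1 - z.2‖ := by
    rw [← smul_sub, sub_sub_sub_cancel_right, norm_smul, Real.norm_of_nonneg hk.le]
  simp only [gagliardoDensity, concentrate, Prod.smul_fst, Prod.smul_snd, Prod.fst_sub,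
    Prod.snd_sub, h1]
  rw [mul_left_comm, ← ENNReal.ofReal_mul (by positivity),
    Real.mul_rpow hk.le (norm_nonneg _), mul_inv, mul_inv_cancel_left₀ (by positivity)]

/-- The Jacobian `k^(-2n)` and the homogeneity `k^(n + sp)` of the density combine to `k^(sp - n)`.
This exceeds the factor `k^(-n)` of `lintegral_concentrate` by `k^(sp)`, which makes the comparison
error negligible. -/
lemma energy_concentrate (hs₀ : 0 < s) (hp : 1 < p) {lam : ℝ} {σ : Rn n → Rn n → ℝ}
    (h : IsElliptic lam σ) (η : Rn n → ℝ) (x₀ : Rn n) {k : ℝ} (hk : 0 < k) :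
    energy s p σ (concentrate η x₀ k) =
      ENNReal.ofReal ((k ^ (n + n))⁻¹) * (ENNReal.ofReal (k ^ (n + s * p)) *
        ∫⁻ w, ENNReal.ofReal (σ (x₀ + k⁻¹ • w.1) (x₀ + k⁻¹ • w.2)) * gagliardoDensity s p η w) := by
  have h1 := lintegral_comp_smul_sub (volume : Measure (Rn n × Rn n))
    (fun w => ENNReal.ofReal (k ^ (n + s * p)) *
      (ENNReal.ofReal (σ (x₀ + k⁻¹ • w.1) (x₀ + k⁻¹ • w.2)) * gagliardoDensity s p η w))
    (x₀, x₀) hk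
  rw [Module.finrank_prod, finrank_euclideanSpace_fin] at h1
  rw [← lintegral_const_mul' _ _ ENNReal.ofReal_ne_top, ← h1, energy, lintegral_weightedMeasure hs₀ hp h]
  refine lintegral_congr fun z => ?_
  rw [gagliardoDensity_concentrate η x₀ hk]
  simp only [Prod.smul_fst, Prod.smul_snd, Prod.fst_sub, Prod.snd_sub, smul_smul,
    inv_mul_cancel₀ hk.ne', one_smul, add_sub_cancel]
  ring

lemma IsTestFunction.concentrate {η : Rn n → ℝ} {R : ℝ}
    (hη : IsTestFunction (Metric.closedBall 0 R) η) (x₀ : Rn n) {k r : ℝ} (hk : 0 < k)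
    (hr : R ≤ k * r) : IsTestFunction (Metric.closedBall x₀ r) (concentrate η x₀ k) := by
  have hsupp : Function.support (FracPLap.concentrate η x₀ k) ⊆ Metric.closedBall x₀ r := by
    intro x hx
    by_contra hxr
    refine hx (hη.eq_zero fun hmem => hxr ?_)
    rw [mem_closedBall_zero_iff, norm_smul, Real.norm_of_nonneg hk.le] at hmem
    rw [Metric.mem_closedBall, dist_eq_norm]
    exact le_of_mul_le_mul_left (hmem.trans hr) hk
  refine ⟨?_, HasCompactSupport.of_support_subset_isCompact (isCompact_closedBall x₀ r) hsupp,
    closure_minimal hsupp Metric.isClosed_closedBall⟩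
  have : ContDiff ℝ ∞ fun x : Rn n => k • (x - x₀) := by fun_prop
  exact hη.1.comp this

lemma measurable_gagliardoDensity {η : Rn n → ℝ} (hη : Continuous η) :
    Measurable (gagliardoDensity s p η) := by
  have := hη.measurable
  unfold gagliardoDensity
  fun_prop

/-- The rescaled energies converge to a multiple of the diagonal value of the coefficient. -/
lemma tendsto_rescaled_energy {lam : ℝ} {σ : Rn n → Rn n → ℝ} (h : IsElliptic lam σ)
    {x₀ : Rn n} (hσ : Tendsto (fun z : Rn n × Rn n => σ z.1 z.2) (𝓝 (x₀, x₀)) (𝓝 (σ x₀ x₀)))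
    {η : Rn n → ℝ} (hη : Continuous η) (hfin : ∫⁻ z, gagliardoDensity s p η z ≠ ⊤)
    {k : ℕ → ℝ} (hk : ∀ j, 0 < k j) (hklim : Tendsto k atTop atTop) :
    Tendsto (fun j => ∫⁻ w, ENNReal.ofReal (σ (x₀ + (k j)⁻¹ • w.1) (x₀ + (k j)⁻¹ • w.2)) *
      gagliardoDensity s p η w) atTop
      (𝓝 (ENNReal.ofReal (σ x₀ x₀) * ∫⁻ z, gagliardoDensity s p η z)) := by
  have hm := measurable_gagliardoDensity (s := s) (p := p) hη
  rw [← lintegral_const_mul _ hm]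
  have hfin' : ∀ᵐ z, gagliardoDensity s p η z < ⊤ := ae_lt_top hm hfin
  refine tendsto_lintegral_of_dominated_convergence'
    (fun z => ENNReal.ofReal lam⁻¹ * gagliardoDensity s p η z) ?_ ?_ ?_ ?_
  · intro j
    have h1 := h.aemeasurable.comp_quasiMeasurePreserving
      (quasiMeasurePreserving_affine volume (x₀, x₀) (inv_pos.2 (hk j)).ne')
    exact h1.ennreal_ofReal.mul hm.aemeasurable
  · intro j
    refine Eventually.of_forall fun z => ?_
    exact mul_le_mul_left (ENNReal.ofReal_le_ofReal (h.ge _ _)) _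
  · rw [lintegral_const_mul _ hm]
    exact ENNReal.mul_ne_top ENNReal.ofReal_ne_top hfin
  · filter_upwards [hfin'] with w hw
    refine ENNReal.Tendsto.mul_const ?_ (Or.inr hw.ne)
    have h1 : Tendsto (fun j => (k j)⁻¹) atTop (𝓝 0) := tendsto_inv_atTop_zero.comp hklim
    have h2 : ∀ v : Rn n, Tendsto (fun j => x₀ + (k j)⁻¹ • v) atTop (𝓝 x₀) := fun v => by
      simpa using (h1.smul_const v).const_add x₀
    have h3 := hσ.comp ((h2 w.1).prodMk_nhds (h2 w.2))
    exact ENNReal.tendsto_ofReal h3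

/-- An admissible coefficient is jointly continuous at the points of the diagonal of `W`. -/
lemma IsAdmissible.tendsto_diag {W : Set (Rn n)} (hW : IsOpen W) {σ : Rn n → Rn n → ℝ}
    (h : IsAdmissible W σ) {x₀ : Rn n} (hx₀ : x₀ ∈ W) :
    Tendsto (fun z : Rn n × Rn n => σ z.1 z.2) (𝓝 (x₀, x₀)) (𝓝 (σ x₀ x₀)) := by
  rw [Metric.tendsto_nhds]
  intro ε hε
  have h1 := h.equicontinuous x₀ hx₀ _ (Metric.dist_mem_uniformity (half_pos hε))
  have h2 := (h.continuousOn x₀ hx₀).continuousAt (hW.mem_nhds hx₀)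
  rw [hW.nhdsWithin_eq hx₀] at h1
  rw [nhds_prod_eq]
  -- The second variable is moved to `x₀` first, with the first variable also moving; this needs
  -- equicontinuity uniformly in the first variable. Continuity of `σ(·, x₀)` then handles the rest.
  filter_upwards [prod_mem_prod (Metric.tendsto_nhds.1 h2 (ε / 2) (half_pos hε)) h1]
    with z hz
  have h3 : dist (σ z.1 x₀) (σ x₀ x₀) < ε / 2 := hz.1
  have h4 : dist (σ z.1 x₀) (σ z.1 z.2) < ε / 2 := hz.2 z.1
  rw [dist_comm] at h4
  linarith [dist_triangle (σ z.1 z.2) (σ z.1 x₀) (σ x₀ x₀)]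

lemma IsAdmissible.exists_isElliptic {W : Set (Rn n)} {σ : Rn n → Rn n → ℝ}
    (h : IsAdmissible W σ) : ∃ lam, IsElliptic lam σ := by
  obtain ⟨lam, h0, h1⟩ := h.elliptic
  exact ⟨lam, h.aemeasurable, h0, fun x y => (h1 x y).1, fun x y => (h1 x y).2⟩

/-- There is a test function of positive Gagliardo seminorm. -/
lemma exists_test_function (hn : 1 ≤ n) (hs₀ : 0 < s) (hp : 1 < p) :
    ∃ η : Rn n → ℝ, IsTestFunction (Metric.closedBall 0 2) η ∧
      ∫⁻ z, gagliardoDensity s p η z ≠ 0 := by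
  have hp0 : 0 < p := by linarith
  let b : ContDiffBump (0 : Rn n) := ⟨1, 2, one_pos, one_lt_two⟩
  have hb : IsTestFunction (Metric.closedBall 0 2) b :=
    ⟨b.contDiff, b.hasCompactSupport, b.tsupport_eq.le⟩
  refine ⟨b, hb, fun h0 => ?_⟩
  -- By Poincaré, zero energy would force zero `L^p` norm, but the bump equals one on the unit ball.
  obtain ⟨C, -, hC⟩ := exists_poincare hn hs₀ hp (Metric.isBounded_closedBall (x := (0 : Rn n))
    (r := 2))
  have h1 := hC b hb.1.continuous.aestronglyMeasurable fun x hx => hb.eq_zero hx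
  rw [lintegral_offDiagMeasure hs₀ hp, h0, mul_zero] at h1
  have h2 : volume (Metric.closedBall (0 : Rn n) 1) ≤ ∫⁻ x, ‖b x‖ₑ ^ p := by
    rw [← lintegral_indicator_one Metric.isClosed_closedBall.measurableSet]
    refine lintegral_mono fun x => ?_
    by_cases hx : x ∈ Metric.closedBall (0 : Rn n) 1
    · have : b x = 1 := b.one_of_mem_closedBall hx
      simp [indicator_of_mem hx, this]
    · simp [indicator_of_notMem hx]
  exact (Metric.measure_closedBall_pos volume (0 : Rn n) one_pos).ne' (le_antisymm (h2.trans h1) zero_le)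

/-- Equal Dirichlet-to-Neumann data order the coefficients on the diagonal of `W`. -/
lemma diag_le_diag (hn : 1 ≤ n) (hs₀ : 0 < s) (hs₁ : s < 1) (hp : 1 < p)
    {Ω W : Set (Rn n)} (hΩ : IsOpen Ω) (hΩb : Bornology.IsBounded Ω)
    (hW : IsOpen W) (hWΩ : W ⊆ exterior Ω) {σ₁ σ₂ : Rn n → Rn n → ℝ}
    (hσ₁ : IsAdmissible W σ₁) (hσ₂ : IsAdmissible W σ₂)
    (hΛ : ∀ f : Rn n → ℝ, IsTestFunction W f → dnMap s p σ₁ Ω f f = dnMap s p σ₂ Ω f f)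
    {x₀ : Rn n} (hx₀ : x₀ ∈ W) : σ₁ x₀ x₀ ≤ σ₂ x₀ x₀ := by
  have hp0 : 0 < p := by linarith
  obtain ⟨lam₁, h₁⟩ := hσ₁.exists_isElliptic
  obtain ⟨lam₂, h₂⟩ := hσ₂.exists_isElliptic
  obtain ⟨η, hη, hηpos⟩ := exists_test_function (n := n) hn hs₀ hp
  have hηfin : ∫⁻ z, gagliardoDensity s p η z ≠ ⊤ :=
    (hη.lintegral_gagliardoDensity_lt_top hn hs₀ hs₁ hp).ne
  obtain ⟨R, hR, hRW⟩ := Metric.isOpen_iff.1 hW x₀ hx₀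
  -- A point of `Ω` within `r` of `B` would lie in the ball of radius `R`, hence in `W`, which is
  -- disjoint from `Ω`.
  set r := R / 2 with hr
  have hr0 : 0 < r := half_pos hR
  set B := Metric.closedBall x₀ r with hB
  have hBW : B ⊆ W := (Metric.closedBall_subset_ball (half_lt_self hR)).trans hRW
  have hΩB : ∀ x ∈ Ω, ∀ y ∈ B, r ≤ ‖x - y‖ := by
    intro x hx y hy
    by_contra! hlt
    rw [hB, Metric.mem_closedBall] at hy
    rw [← dist_eq_norm] at hlt
    have : x ∈ W := hRW (by
      rw [Metric.mem_ball]
      linarith [dist_triangle x y x₀])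
    exact hWΩ this (subset_closure hx)
  -- Starting at `2 / r` ensures `2 ≤ k r`, so the rescaled bump, whose profile has support in
  -- radius `2`, is always supported in `B`.
  set k : ℕ → ℝ := fun j => 2 / r + j with hk
  have hk0 : ∀ j, 0 < k j := fun j => by positivity
  have hklim : Tendsto k atTop atTop :=
    tendsto_atTop_add_const_left _ _ tendsto_natCast_atTop_atTop
  set C : ℝ≥0∞ := 2 * (ENNReal.ofReal lam₁⁻¹ * ENNReal.ofReal ((r ^ (n + s * p))⁻¹) * volume Ω)
    with hC
  have hCtop : C ≠ ⊤ := ENNReal.mul_ne_top (by simp) (ENNReal.mul_ne_top (ENNReal.mul_ne_top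
    ENNReal.ofReal_ne_top ENNReal.ofReal_ne_top) hΩb.measure_lt_top.ne)
  set A : ℝ≥0∞ := ∫⁻ x, ‖η x‖ₑ ^ p with hA
  have hAtop : A ≠ ⊤ := by
    rw [hA, ← eLpNorm_rpow _ hp]
    exact ENNReal.rpow_ne_top_of_nonneg hp0.le (hη.memLp _).2.ne
  have hkey : ∀ j, ∫⁻ w, ENNReal.ofReal (σ₁ (x₀ + (k j)⁻¹ • w.1) (x₀ + (k j)⁻¹ • w.2)) *
      gagliardoDensity s p η w ≤
      (∫⁻ w, ENNReal.ofReal (σ₂ (x₀ + (k j)⁻¹ • w.1) (x₀ + (k j)⁻¹ • w.2)) *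
      gagliardoDensity s p η w) + ENNReal.ofReal (k j ^ (-(s * p))) * (C * A) := by
    intro j
    have hkj := hk0 j
    have hf : IsTestFunction B (concentrate η x₀ (k j)) := by
      refine hη.concentrate x₀ hkj ?_
      have : 2 / r * r = 2 := div_mul_cancel₀ _ hr0.ne'
      have : (0 : ℝ) ≤ j * r := by positivity
      simp only [hk]
      linarith
    have h3 := energy_le_of_dnMap_eq hn hs₀ hs₁ hp hΩb hΩ.measurableSet h₁ h₂ hr0 hΩB hf
      (hΛ _ ⟨hf.1, hf.2.1, hf.2.2.trans hBW⟩)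
    rw [energy_concentrate hs₀ hp h₁ η x₀ hkj, energy_concentrate hs₀ hp h₂ η x₀ hkj,
      lintegral_concentrate η x₀ hkj, ← mul_assoc, ← mul_assoc,
      ← ENNReal.ofReal_mul (by positivity)] at h3
    -- The common factor `k^(sp - n)` of both energies; dividing by it leaves `k^(-sp)` in front of
    -- the error.
    set c : ℝ := (k j ^ (n + n))⁻¹ * k j ^ (n + s * p) with hc
    have hc0 : 0 < c := by positivity
    have hcn : (k j ^ n)⁻¹ = c * k j ^ (-(s * p)) := by
      rw [hc, mul_assoc, ← Real.rpow_add hkj, add_neg_cancel_right, Real.rpow_natCast, pow_add]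
      field_simp
    rw [hcn, ENNReal.ofReal_mul hc0.le, ← hC, ← hA] at h3
    refine (ENNReal.mul_le_mul_iff_right (ENNReal.ofReal_pos.2 hc0).ne'
      ENNReal.ofReal_ne_top).1 (h3.trans (le_of_eq ?_))
    ring
  have hlim₁ := tendsto_rescaled_energy h₁ (hσ₁.tendsto_diag hW hx₀) hη.1.continuous hηfin hk0 hklim
  have hlim₂ := tendsto_rescaled_energy h₂ (hσ₂.tendsto_diag hW hx₀) hη.1.continuous hηfin hk0 hklim
  have hlim₃ : Tendsto (fun j => ENNReal.ofReal (k j ^ (-(s * p))) * (C * A)) atTop (𝓝 0) := by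
    have h3 := (tendsto_rpow_neg_atTop (mul_pos hs₀ hp0)).comp hklim
    have h4 := ENNReal.Tendsto.mul_const (ENNReal.tendsto_ofReal h3)
      (Or.inr (ENNReal.mul_ne_top hCtop hAtop))
    simpa using h4
  have hfinal := le_of_tendsto_of_tendsto' hlim₁ (hlim₂.add hlim₃) hkey
  rw [add_zero, ENNReal.mul_le_mul_iff_left hηpos hηfin] at hfinal
  exact (ENNReal.ofReal_le_ofReal_iff (h₂.pos.le.trans (h₂.le _ _))).1 hfinal

end Scaling

end FracPLap

theorem proposition1p2 (n : ℕ) (hn : 1 ≤ n) (s p : ℝ) (hs₀ : 0 < s) (hs₁ : s < 1) (hp : 1 < p)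
    (Ω W : Set (FracPLap.Rn n)) (hΩ : IsOpen Ω) (hΩb : Bornology.IsBounded Ω)
    (hW : IsOpen W) (hWne : W.Nonempty) (hWΩ : W ⊆ FracPLap.exterior Ω)
    (σ₁ σ₂ : FracPLap.Rn n → FracPLap.Rn n → ℝ)
    (hσ₁ : FracPLap.IsAdmissible W σ₁) (hσ₂ : FracPLap.IsAdmissible W σ₂)
    (hΛ : ∀ f : FracPLap.Rn n → ℝ, FracPLap.IsTestFunction W f →
      FracPLap.EqAsDistributionOn W
        (FracPLap.dnMap s p σ₁ Ω f) (FracPLap.dnMap s p σ₂ Ω f)) :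
    ∀ x ∈ W, σ₁ x x = σ₂ x x := by
  intro x hx
  exact le_antisymm
    (FracPLap.diag_le_diag hn hs₀ hs₁ hp hΩ hΩb hW hWΩ hσ₁ hσ₂ (fun f hf => hΛ f hf f hf) hx)
    (FracPLap.diag_le_diag hn hs₀ hs₁ hp hΩ hΩb hW hWΩ hσ₂ hσ₁
      (fun f hf => (hΛ f hf f hf).symm) hx)
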